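/- **Setting.** Work with quantifier-free formulas of linear integer arithmetic with arrays (sorts $\mathsf{int}$ and $\mathsf{array}$, indices and elements of sort $\mathsf{int}$), interpreted in the standard way, over uninterpreted constants $X\cup X'\cup SK$: the program variables $X$, their primed copy $X'$, and Skolem constants $sk_i$, one for each variable $v_i$. A *safety problem* is a triple $\langle \mathit{Init}(X),\mathit{Tr}(X,X'),\mathit{Bad}(X)\rangle$ of quantifier-free ground formulas, where $\mathit{Bad}$ is a monomial (conjunction of literals). It has a *counterexample of length $k$* if $\mathit{BMC}_k=\mathit{Init}(X_0)\wedge\bigwedge_{i<k}\mathit{Tr}(X_i,X_{i+1})\wedge \mathit{Bad}(X_k)$ is satisfiable. Write $m'_{sk}$ for $m$ with every variable $v_i$ replaced by $sk_i$ and every program variable primed (deterministic skolemization), $\forall\varphi$, $\exists\varphi$ for the universal and existential closure, and $\mathit{Const}(\varphi)$ for the set of uninterpreted constants of $\varphi$. The following functions are given. * $\mathit{abs}(U,\varphi)=(\psi,\sigma)$ for a set $U$ of constants and ground $\varphi$: $\psi$ is $\varphi$ with the constants of $U$ replaced by variables, distinct ones for distinct constants and $v_i$ for $sk_i$, and $\sigma$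 is the inverse substitution, so that $\psi\sigma=\varphi$. * $\mathit{pMbp}(U,\varphi,M)=(\psi,W)$ for ground $\varphi$, $U\subseteq \mathit{Const}(\varphi)$, $M\models\varphi$: $\psi$ is a ground monomial, $W\subseteq U$, $\mathit{Const}(\psi)\subseteq \mathit{Const}(\varphi)\setminus(U\setminus W)$, $\psi\Rightarrow\exists (U\setminus W)\cdot\varphi$, $M\models\psi$, and for fixed $U,\varphi$ only finitely many results occur. ($W$ may contain array constants; if it never does in the calls below, all variables that occur in proof obligations have sort $\mathsf{int}$.) * $\mathit{pItp}(A,B)=(\varphi,U)$ for ground $A$ and a ground monomial $B$ with $A\Rightarrow\neg B$: $\varphi$ is a ground clause, $U\subseteq \mathit{Const}(B)\setminus \mathit{Const}(A)$, $\mathit{Const}(\varphi)\subseteq(\mathit{Const}(A)\cap \mathit{Const}(B))\cup U$, $A\Rightarrow\forall U\cdot\varphi$, and $\varphi\Rightarrow\neg B$. **Procedure** $\texttt{Quic3\_Main}$. It keeps a level $N$ and finite sets $Q_0,Q_1,\dots$ of pairs $(\ell,\sigma)$ (a lemma $\forall\ell$ over $X$ with its ground instance $\ell\sigma$). Let $\mathit{qi}(Q)=\{\ell\sigma\mid(\ell,\sigma)\in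 Q\}$, $\forall Q=\{\forall\ell\mid(\ell,\sigma)\in Q\}$ and $\mathcal F(A)=(A\wedge \mathit{Tr})\vee \mathit{Init}(X')$. Start with $N=0$, $Q_0=\{(\mathit{Init},\emptyset)\}$ and all other $Q_i$ empty; if $\mathit{Init}\wedge \mathit{Bad}$ is satisfiable, return *Cex*. Otherwise repeat: set $N\gets N+1$, $Q_N\gets\emptyset$, and run the following two phases. * *MakeSafe.* Start with the queue $\mathcal Q=\{\langle \mathit{Bad},\emptyset,N\rangle\}$. While $\mathcal Q\ne\emptyset$, take from it (without removing it) a proof obligation $\langle m,\xi,i\rangle$ of least level $i$. If $i=0$, return *Cex*. If $\mathit{qi}(Q_{i-1})\wedge \mathit{Tr}\wedge m'_{sk}$ has a model, let $M$ be any model of it, let $(\varphi,W)=\mathit{pMbp}(U,\mathit{Tr}\wedge m'_{sk},M)$, where $U$ is the set of constants of $\mathit{Tr}\wedge m'_{sk}$ in $X'\cup SK$, let $(\psi,\sigma)=\mathit{abs}(W,\varphi)$, and add $\langle\psi,\sigma,i-1\rangle$ to $\mathcal Q$. If it has no model, remove $\langle m,\xi,i\rangle$ from $\mathcal Q$, let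 $L'$ be the clause of $\mathit{pItp}(\mathcal F(\mathit{qi}(Q_{i-1})),m'_{sk})$, let $(\ell,\_)=\mathit{abs}(SK,L)$, and add to all $Q_j$, $j\le i$, either $(\ell,\xi)$ or any quantified generalization of it, that is, any $(g,\tau)$ with $g$ over $X$, $g\tau$ ground, $g\tau\equiv\ell\xi$, every free variable of $\ell$ free in $g$, and $\mathcal F(\mathit{qi}(Q_{i-1}))\Rightarrow\forall g'$. * *Push.* Apply the following rule any number of times, in any order: if $i<N$, $(\varphi\vee\psi,\sigma)\in Q_i$ (with $\psi$ a possibly empty part of the disjunction), $(\varphi,\sigma)\notin Q_{i+1}$, $\mathit{Init}\Rightarrow\forall\varphi$ and $\forall\varphi\wedge\forall Q_i\wedge \mathit{qi}(Q_i)\wedge \mathit{Tr}\Rightarrow\forall\varphi'$, add $(\varphi,\sigma)$ to all $Q_j$ with $j\le i+1$. After that, if $\forall Q_i\subseteq\forall Q_{i+1}$ for some $i<N$, return *Safe*. **Statement.** Suppose that the safety problem has a counterexample. Then, for all functions $\mathit{abs}$, $\mathit{pMbp}$, $\mathit{pItp}$ as above and all choices made during the run, $\texttt{Quic3\_Main}$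 terminates and returns *Cex* with a shortest counterexample: the level $N$ at termination is the least length of a counterexample, and there is a counterexample of length $N$ whose $j$-th state satisfies $\exists m$ for every proof obligation $\langle m,\sigma,j\rangle$ in the final queue, which, if $N>0$, contains a proof obligation of every level $0,\dots,N$. (If $N=0$, *Cex* is returned by the initial test, with an empty queue.) -/

import Mathlib

namespace Quic3

universe u w

/-! ### Quantifier-free formulas over linear integer arithmetic and arrays -/

/-- The two sorts; array indices and array elements are integers. -/
inductive Srt
  | int
  | array

/-- The standard domains of the sorts. -/
abbrev Val : Srt → Type
  | .int => ℤ
  | .array => ℤ → ℤ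

/-- Sorted variables `v_i`. -/
abbrev Var := Srt × ℕ

/-- Terms over a sorted family `C` of uninterpreted constants. Multiplication is linear, that is,
by a numeral. -/
inductive Term (C : Srt → Type u) : Srt → Type u
  | var (s : Srt) (n : ℕ) : Term C s
  | const {s : Srt} (c : C s) : Term C s
  | num (z : ℤ) : Term C .int
  | plus (a b : Term C .int) : Term C .int
  | minus (a b : Term C .int) : Term C .int
  | scale (z : ℤ) (a : Term C .int) : Term C .int
  | sel (a : Term C .array) (i : Term C .int) : Term C .int
  | store (a : Term C .array) (i x : Term C .int) : Term C .array

/-- Quantifier-free formulas. -/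
inductive Fml (C : Srt → Type u) : Type u
  | tt : Fml C
  | ff : Fml C
  | eq {s : Srt} (a b : Term C s) : Fml C
  | lt (a b : Term C .int) : Fml C
  | le (a b : Term C .int) : Fml C
  | not (p : Fml C) : Fml C
  | and (p q : Fml C) : Fml C
  | or (p q : Fml C) : Fml C

/-- Uninterpreted constants of `C`, of either sort. -/
abbrev Sym (C : Srt → Type u) := Σ s, C s

/-- Partial substitutions from variables to terms of the same sort. -/
abbrev Subst (C : Srt → Type u) := (s : Srt) → ℕ → Option (Term C s)

/-- The empty substitution. -/
def Subst.empty {C : Srt → Type u} : Subst C := fun _ _ => none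

/-- The domain of a substitution. -/
def Subst.dom {C : Srt → Type u} (σ : Subst C) : Set Var := {v | ∃ t, σ v.1 v.2 = some t}

/-- Structures over the signature with uninterpreted constants `C`. -/
abbrev Interp (C : Srt → Type u) := (s : Srt) → C s → Val s

/-- Values for the variables. -/
abbrev Valuation := (s : Srt) → ℕ → Val s

namespace Term

variable {C : Srt → Type u} {D : Srt → Type w}

/-- Free variables. -/
def fvars : {s : Srt} → Term C s → Set Var
  | _, .var s n => {(s, n)}
  | _, .const _ => ∅
  | _, .num _ => ∅
  | _, .plus a b => a.fvars ∪ b.fvars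
  | _, .minus a b => a.fvars ∪ b.fvars
  | _, .scale _ a => a.fvars
  | _, .sel a i => a.fvars ∪ i.fvars
  | _, .store a i x => a.fvars ∪ i.fvars ∪ x.fvars

/-- Uninterpreted constants that occur. -/
def consts : {s : Srt} → Term C s → Set (Sym C)
  | _, .var _ _ => ∅
  | _, .const c => {⟨_, c⟩}
  | _, .num _ => ∅
  | _, .plus a b => a.consts ∪ b.consts
  | _, .minus a b => a.consts ∪ b.consts
  | _, .scale _ a => a.consts
  | _, .sel a i => a.consts ∪ i.consts
  | _, .store a i x => a.consts ∪ i.consts ∪ x.consts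

/-- Application of a substitution; variables outside its domain stay. -/
def subst (σ : Subst C) : {s : Srt} → Term C s → Term C s
  | _, .var s n => (σ s n).getD (.var s n)
  | _, .const c => .const c
  | _, .num z => .num z
  | _, .plus a b => .plus (a.subst σ) (b.subst σ)
  | _, .minus a b => .minus (a.subst σ) (b.subst σ)
  | _, .scale z a => .scale z (a.subst σ)
  | _, .sel a i => .sel (a.subst σ) (i.subst σ)
  | _, .store a i x => .store (a.subst σ) (i.subst σ) (x.subst σ)

/-- Renaming of constants. -/
def rename (f : (s : Srt) → C s → D s) : {s : Srt} → Term C s → Term D s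
  | _, .var s n => .var s n
  | _, .const c => .const (f _ c)
  | _, .num z => .num z
  | _, .plus a b => .plus (a.rename f) (b.rename f)
  | _, .minus a b => .minus (a.rename f) (b.rename f)
  | _, .scale z a => .scale z (a.rename f)
  | _, .sel a i => .sel (a.rename f) (i.rename f)
  | _, .store a i x => .store (a.rename f) (i.rename f) (x.rename f)

/-- The value of a term. -/
def eval (M : Interp C) (v : Valuation) : {s : Srt} → Term C s → Val s
  | _, .var s n => v s n
  | _, .const c => M _ c
  | _, .num z => z
  | _, .plus a b => ((a.eval M v : ℤ) + (b.eval M v : ℤ) : ℤ)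
  | _, .minus a b => ((a.eval M v : ℤ) - (b.eval M v : ℤ) : ℤ)
  | _, .scale z a => (z * (a.eval M v : ℤ) : ℤ)
  | _, .sel a i => (a.eval M v : ℤ → ℤ) (i.eval M v)
  | _, .store a i x => Function.update (a.eval M v : ℤ → ℤ) (i.eval M v) (x.eval M v)

end Term

namespace Fml

variable {C : Srt → Type u} {D : Srt → Type w}

/-- Free variables. -/
def fvars : Fml C → Set Var
  | .tt => ∅
  | .ff => ∅
  | .eq a b => a.fvars ∪ b.fvars
  | .lt a b => a.fvars ∪ b.fvars
  | .le a b => a.fvars ∪ b.fvars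
  | .not p => p.fvars
  | .and p q => p.fvars ∪ q.fvars
  | .or p q => p.fvars ∪ q.fvars

/-- Uninterpreted constants that occur. -/
def consts : Fml C → Set (Sym C)
  | .tt => ∅
  | .ff => ∅
  | .eq a b => a.consts ∪ b.consts
  | .lt a b => a.consts ∪ b.consts
  | .le a b => a.consts ∪ b.consts
  | .not p => p.consts
  | .and p q => p.consts ∪ q.consts
  | .or p q => p.consts ∪ q.consts

/-- Application of a substitution. -/
def subst (σ : Subst C) : Fml C → Fml C
  | .tt => .tt
  | .ff => .ff
  | .eq a b => .eq (a.subst σ) (b.subst σ)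
  | .lt a b => .lt (a.subst σ) (b.subst σ)
  | .le a b => .le (a.subst σ) (b.subst σ)
  | .not p => .not (p.subst σ)
  | .and p q => .and (p.subst σ) (q.subst σ)
  | .or p q => .or (p.subst σ) (q.subst σ)

/-- Renaming of constants. -/
def rename (f : (s : Srt) → C s → D s) : Fml C → Fml D
  | .tt => .tt
  | .ff => .ff
  | .eq a b => .eq (a.rename f) (b.rename f)
  | .lt a b => .lt (a.rename f) (b.rename f)
  | .le a b => .le (a.rename f) (b.rename f)
  | .not p => .not (p.rename f)
  | .and p q => .and (p.rename f) (q.rename f)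
  | .or p q => .or (p.rename f) (q.rename f)

/-- Truth in a structure, for given values of the free variables. -/
def Holds (M : Interp C) (v : Valuation) : Fml C → Prop
  | .tt => True
  | .ff => False
  | .eq a b => a.eval M v = b.eval M v
  | .lt a b => (a.eval M v : ℤ) < (b.eval M v : ℤ)
  | .le a b => (a.eval M v : ℤ) ≤ (b.eval M v : ℤ)
  | .not p => ¬ p.Holds M v
  | .and p q => p.Holds M v ∧ q.Holds M v
  | .or p q => p.Holds M v ∨ q.Holds M v

/-- A formula is ground if it has no variables. -/
def Ground (p : Fml C) : Prop := p.fvars = ∅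

/-- Conjunction of a list of formulas. -/
def conj : List (Fml C) → Fml C
  | [] => .tt
  | p :: l => .and p (conj l)

/-- Atoms. -/
inductive IsAtom : Fml C → Prop
  | eq {s : Srt} (a b : Term C s) : IsAtom (.eq a b)
  | lt (a b : Term C .int) : IsAtom (.lt a b)
  | le (a b : Term C .int) : IsAtom (.le a b)

/-- Literals. -/
inductive IsLiteral : Fml C → Prop
  | pos {p : Fml C} : IsAtom p → IsLiteral p
  | neg {p : Fml C} : IsAtom p → IsLiteral (.not p)

/-- Monomials (cubes): conjunctions of literals. -/
inductive IsMonomial : Fml C → Prop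
  | tt : IsMonomial .tt
  | lit {p : Fml C} : IsLiteral p → IsMonomial p
  | and {p q : Fml C} : IsMonomial p → IsMonomial q → IsMonomial (.and p q)

/-- Clauses: disjunctions of literals. -/
inductive IsClause : Fml C → Prop
  | ff : IsClause .ff
  | lit {p : Fml C} : IsLiteral p → IsClause p
  | or {p q : Fml C} : IsClause p → IsClause q → IsClause (.or p q)

/-- `SubDisj p q`: up to the order of disjuncts, `q` is `p ∨ r` for a possibly empty disjunction
`r`; that is, `p` arises from `q` by deleting some disjuncts. -/
inductive SubDisj : Fml C → Fml C → Prop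
  | refl (p : Fml C) : SubDisj p p
  | left {p a b : Fml C} : SubDisj p a → SubDisj p (.or a b)
  | right {p a b : Fml C} : SubDisj p b → SubDisj p (.or a b)
  | both {p q a b : Fml C} : SubDisj p a → SubDisj q b → SubDisj (.or p q) (.or a b)

end Fml

section Semantics

variable {C : Srt → Type u}

/-- `M ⊨ ∀ p`, the truth of the universal closure; for ground `p` this is `M ⊨ p`. -/
def Models (M : Interp C) (p : Fml C) : Prop := ∀ v, p.Holds M v

/-- `M ⊨ ∃ p`, the truth of the existential closure. -/
def ModelsEx (M : Interp C) (p : Fml C) : Prop := ∃ v, p.Holds M v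

/-- Satisfiability of a ground formula. -/
def Satisfiable (p : Fml C) : Prop := ∃ M, Models M p

/-- `p ⇒ q`, more precisely `∀ p ⇒ ∀ q`. -/
def Entails (p q : Fml C) : Prop := ∀ M, Models M p → Models M q

/-- `M` and `M₁` interpret all constants outside `U` in the same way. -/
def AgreeOff (U : Set (Sym C)) (M M₁ : Interp C) : Prop :=
  ∀ (s : Srt) (c : C s), (⟨s, c⟩ : Sym C) ∉ U → M₁ s c = M s c

end Semantics

/-! ### The signature of the procedure: `X`, its primed copy, and the Skolem constants -/

/-- The constants `X ∪ X' ∪ SK` over the program variables `X`. -/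
inductive Con (X : Srt → Type u) : Srt → Type u
  | base {s : Srt} (a : X s) : Con X s
  | primed {s : Srt} (a : X s) : Con X s
  | sk (s : Srt) (n : ℕ) : Con X s

variable {X : Srt → Type u}

/-- The unprimed constants `X`. -/
def baseSyms (X : Srt → Type u) : Set (Sym (Con X)) := {c | ∃ (s : Srt) (a : X s), c = ⟨s, .base a⟩}

/-- The Skolem constants `SK`. -/
def skSyms (X : Srt → Type u) : Set (Sym (Con X)) := {c | ∃ (s : Srt) (n : ℕ), c = ⟨s, .sk s n⟩}

/-- `X' ∪ SK`. -/
def elimSyms (X : Srt → Type u) : Set (Sym (Con X)) :=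
  {c | ∃ (s : Srt) (a : X s), c = ⟨s, .primed a⟩} ∪ skSyms X

/-- Priming of constants. -/
def Con.prime : (s : Srt) → Con X s → Con X s
  | _, .base a => .primed a
  | _, .primed a => .primed a
  | _, .sk s n => .sk s n

/-- The inverse of priming, on `X' ∪ SK`. -/
def Con.unprime : (s : Srt) → Con X s → Con X s
  | _, .base a => .base a
  | _, .primed a => .base a
  | _, .sk s n => .sk s n

/-- `φ'`, for a formula over `X ∪ SK`. -/
def Fml.prime (p : Fml (Con X)) : Fml (Con X) := p.rename Con.prime

/-- The formula `L` with `L' = p`, for a formula `p` over `X' ∪ SK`. -/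
def Fml.unprime (p : Fml (Con X)) : Fml (Con X) := p.rename Con.unprime

/-- The deterministic Skolem substitution `v_i ↦ sk_i`. -/
def skSubst : Subst (Con X) := fun s n => some (.const (.sk s n))

/-- `m'_sk`. -/
def Fml.primeSk (m : Fml (Con X)) : Fml (Con X) := (m.subst skSubst).prime

/-! ### Abstraction, model based projection and interpolation -/

/-- `abs (U, φ) = (ψ, σ)` replaces, in a ground formula `φ`, the constants from `U` by variables,
one variable for each constant, and `σ` maps these variables back. Skolem constants `sk_i` are
replaced by `v_i`. -/
structure IsAbs (abs : Set (Sym (Con X)) → Fml (Con X) → Fml (Con X) × Subst (Con X)) : Prop where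
  subst_eq : ∀ U p, p.Ground → (abs U p).1.subst (abs U p).2 = p
  dom_eq : ∀ U p, p.Ground → (abs U p).2.dom = (abs U p).1.fvars \ p.fvars
  disjoint : ∀ U p, p.Ground → Disjoint U (abs U p).1.consts
  range : ∀ U p, p.Ground → ∀ s n t, (abs U p).2 s n = some t →
    ∃ c : Con X s, t = .const c ∧ (⟨s, c⟩ : Sym (Con X)) ∈ U
  inj : ∀ U p, p.Ground → ∀ s n k t,
    (abs U p).2 s n = some t → (abs U p).2 s k = some t → n = k
  skolem : ∀ U p, p.Ground → ∀ s n, (⟨s, .sk s n⟩ : Sym (Con X)) ∈ U ∩ p.consts →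
    (abs U p).2 s n = some (.const (.sk s n))

/-- Partial model based projection `pMbp (U, φ, M) = (ψ, W)`, for ground `φ`, `U ⊆ Const φ` and
`M ⊨ φ`. -/
structure IsPMbp
    (mbp : Set (Sym (Con X)) → Fml (Con X) → Interp (Con X) → Fml (Con X) × Set (Sym (Con X))) :
    Prop where
  ground : ∀ U p M, p.Ground → U ⊆ p.consts → Models M p → (mbp U p M).1.Ground
  monomial : ∀ U p M, p.Ground → U ⊆ p.consts → Models M p → (mbp U p M).1.IsMonomial
  subset : ∀ U p M, p.Ground → U ⊆ p.consts → Models M p → (mbp U p M).2 ⊆ U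
  consts : ∀ U p M, p.Ground → U ⊆ p.consts → Models M p →
    (mbp U p M).1.consts ⊆ p.consts \ (U \ (mbp U p M).2)
  under : ∀ U p M, p.Ground → U ⊆ p.consts → Models M p →
    ∀ I, Models I (mbp U p M).1 → ∃ J, AgreeOff (U \ (mbp U p M).2) I J ∧ Models J p
  model : ∀ U p M, p.Ground → U ⊆ p.consts → Models M p → Models M (mbp U p M).1
  finite_range : ∀ U p, p.Ground → U ⊆ p.consts → {r | ∃ M, Models M p ∧ r = mbp U p M}.Finite

/-- Partial interpolation `pItp (A, B) = (φ, U)`, for ground `A` and a ground monomial `B` with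
`A ⇒ ¬ B`. -/
structure IsPItp (itp : Fml (Con X) → Fml (Con X) → Fml (Con X) × Set (Sym (Con X))) :
    Prop where
  ground : ∀ A B, A.Ground → B.Ground → B.IsMonomial → Entails A B.not → (itp A B).1.Ground
  clause : ∀ A B, A.Ground → B.Ground → B.IsMonomial → Entails A B.not → (itp A B).1.IsClause
  subset : ∀ A B, A.Ground → B.Ground → B.IsMonomial → Entails A B.not →
    (itp A B).2 ⊆ B.consts \ A.consts
  consts : ∀ A B, A.Ground → B.Ground → B.IsMonomial → Entails A B.not →
    (itp A B).1.consts ⊆ (A.consts ∩ B.consts) ∪ (itp A B).2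
  left : ∀ A B, A.Ground → B.Ground → B.IsMonomial → Entails A B.not →
    ∀ I J, Models I A → AgreeOff (itp A B).2 I J → Models J (itp A B).1
  right : ∀ A B, A.Ground → B.Ground → B.IsMonomial → Entails A B.not →
    Entails (itp A B).1 B.not

/-! ### Safety problems and counterexamples -/

/-- A safety problem `⟨Init(X), Tr(X, X'), Bad(X)⟩` with quantifier-free ground formulas. In `tr`
the left copy of `X` is the pre-state and the right copy the post-state. -/
structure SafetyProblem (X : Srt → Type u) where
  init : Fml X
  tr : Fml (fun s => X s ⊕ X s)
  bad : Fml X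
  init_ground : init.Ground
  tr_ground : tr.Ground
  bad_ground : bad.Ground

/-- Constants `a_i`, for `a ∈ X` and `i ∈ ℕ`. -/
abbrev Timed (X : Srt → Type u) : Srt → Type u := fun s => ℕ × X s

namespace SafetyProblem

/-- `BMC_k = Init(X_0) ∧ ⋀_{i < k} Tr(X_i, X_{i+1}) ∧ Bad(X_k)`. -/
def bmc (P : SafetyProblem X) (k : ℕ) : Fml (Timed X) :=
  .and (P.init.rename fun _ a => (0, a))
    (.and
      (Fml.conj ((List.range k).map fun i =>
        P.tr.rename fun _ a => Sum.elim (fun b => (i, b)) (fun b => (i + 1, b)) a))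
      (P.bad.rename fun _ a => (k, a)))

/-- There is a counterexample of length `k`. -/
def HasCex (P : SafetyProblem X) (k : ℕ) : Prop := Satisfiable (P.bmc k)

/-- `Init(X)`. -/
def initC (P : SafetyProblem X) : Fml (Con X) := P.init.rename fun _ a => .base a

/-- `Tr(X, X')`. -/
def trC (P : SafetyProblem X) : Fml (Con X) := P.tr.rename fun _ a => Sum.elim .base .primed a

/-- `Bad(X)`. -/
def badC (P : SafetyProblem X) : Fml (Con X) := P.bad.rename fun _ a => .base a

end SafetyProblem

/-! ### The procedure -/

/-- A pair `(ℓ, σ)`, for the quantified lemma `∀ ℓ` and its instance `ℓσ`. -/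
abbrev QLemma (X : Srt → Type u) := Fml (Con X) × Subst (Con X)

/-- A trace `Q_0, Q_1, …`; the finite sets `Q_i` are represented by lists. -/
abbrev Trace (X : Srt → Type u) := ℕ → List (QLemma X)

/-- A proof obligation `⟨m, σ, i⟩`. -/
structure Pob (X : Srt → Type u) where
  cube : Fml (Con X)
  subst : Subst (Con X)
  level : ℕ

/-- `qi(Q)`, the conjunction of the instances `ℓσ` for `(ℓ, σ) ∈ Q`. -/
def qi (Q : List (QLemma X)) : Fml (Con X) := Fml.conj (Q.map fun l => l.1.subst l.2)

/-- `∀ Q ⊆ ∀ Q₁`, as sets of formulas. -/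
def AllSubset (Q Q₁ : List (QLemma X)) : Prop := ∀ l ∈ Q, ∃ l₁ ∈ Q₁, l₁.1 = l.1

/-- Addition of a lemma to `Q_j` for all `j ≤ i`. -/
def Trace.insert (Q : Trace X) (i : ℕ) (l : QLemma X) : Trace X :=
  fun j => if j ≤ i then l :: Q j else Q j

/-- `Q_N ← ∅`. -/
def Trace.clear (Q : Trace X) (N : ℕ) : Trace X := Function.update Q N []

/-- `p` is a proof obligation of minimal level in the queue. -/
def IsTop (p : Pob X) (K : Set (Pob X)) : Prop := p ∈ K ∧ ∀ q ∈ K, p.level ≤ q.level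

namespace SafetyProblem

/-- `F(A) = (A(X) ∧ Tr(X, X')) ∨ Init(X')`. -/
def forward (P : SafetyProblem X) (A : Fml (Con X)) : Fml (Con X) :=
  .or (.and A P.trC) P.initC.prime

/-- The initial trace. -/
def trace₀ (P : SafetyProblem X) : Trace X :=
  fun i => if i = 0 then [(P.initC, Subst.empty)] else []

/-- The proof obligation `⟨Bad, ∅, N⟩`. -/
def badPob (P : SafetyProblem X) (N : ℕ) : Pob X := ⟨P.badC, Subst.empty, N⟩

/-- The possible results `(g, τ)` of the optional quantified generalization of the lemma `(ℓ, ξ)`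
that is to be added at the level above the frame `Q`. -/
def QGen (P : SafetyProblem X) (Q : List (QLemma X)) (l g : QLemma X) : Prop :=
  g = l ∨
    (g.1.consts ⊆ baseSyms X ∧ (g.1.subst g.2).Ground ∧
      (∀ M, Models M (g.1.subst g.2) ↔ Models M (l.1.subst l.2)) ∧
      l.1.fvars ⊆ g.1.fvars ∧
      Entails (P.forward (qi Q)) g.1.prime)

/-- The rule Push for frame `i`, which adds `(φ, σ)` to the frames up to `i + 1`. -/
def PushRule (P : SafetyProblem X) (N : ℕ) (Q : Trace X) (i : ℕ) (l : QLemma X) : Prop :=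
  i < N ∧ (∃ d, (d, l.2) ∈ Q i ∧ Fml.SubDisj l.1 d) ∧ l ∉ Q (i + 1) ∧ Entails P.initC l.1 ∧
    ∀ M, Models M l.1 → (∀ k ∈ Q i, Models M k.1) → Models M (qi (Q i)) → Models M P.trC →
      Models M l.1.prime

end SafetyProblem

/-- Control points of the main procedure, with the current data: at the start; in the loop of
`MakeSafe`, with level `N`, trace and queue; in `Push`; and the two results. -/
inductive Cfg (X : Srt → Type u)
  | start : Cfg X
  | makeSafe (N : ℕ) (Q : Trace X) (K : Set (Pob X)) : Cfg X
  | push (N : ℕ) (Q : Trace X) : Cfg X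
  | cex (N : ℕ) (K : Set (Pob X)) : Cfg X
  | safe (N : ℕ) : Cfg X

/-- The steps of `Quic3_Main`. The satisfiability solver may return any model, the quantified
generalization any admissible lemma, and `Push` may apply its rule to any lemmas it can and stop
at any moment. -/
inductive Step (P : SafetyProblem X)
    (abs : Set (Sym (Con X)) → Fml (Con X) → Fml (Con X) × Subst (Con X))
    (mbp : Set (Sym (Con X)) → Fml (Con X) → Interp (Con X) → Fml (Con X) × Set (Sym (Con X)))
    (itp : Fml (Con X) → Fml (Con X) → Fml (Con X) × Set (Sym (Con X))) :
    Cfg X → Cfg X → Prop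
  | startCex : Satisfiable (.and P.initC P.badC) → Step P abs mbp itp .start (.cex 0 ∅)
  | startLoop : ¬ Satisfiable (.and P.initC P.badC) →
      Step P abs mbp itp .start (.makeSafe 1 (P.trace₀.clear 1) {P.badPob 1})
  | cex {N : ℕ} {Q : Trace X} {K : Set (Pob X)} {p : Pob X} :
      IsTop p K → p.level = 0 → Step P abs mbp itp (.makeSafe N Q K) (.cex N K)
  | predecessor {N : ℕ} {Q : Trace X} {K : Set (Pob X)} {p : Pob X} {i : ℕ}
      {M : Interp (Con X)} {T φ ψ : Fml (Con X)} {W : Set (Sym (Con X))} {σ : Subst (Con X)} :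
      IsTop p K → p.level = i + 1 →
      Models M (.and (qi (Q i)) (.and P.trC p.cube.primeSk)) →
      T = .and P.trC p.cube.primeSk →
      (φ, W) = mbp (elimSyms X ∩ T.consts) T M →
      (ψ, σ) = abs W φ →
      Step P abs mbp itp (.makeSafe N Q K) (.makeSafe N Q (insert ⟨ψ, σ, i⟩ K))
  | newLemma {N : ℕ} {Q : Trace X} {K : Set (Pob X)} {p : Pob X} {i : ℕ}
      {L ℓ : Fml (Con X)} {g : QLemma X} :
      IsTop p K → p.level = i + 1 →
      ¬ Satisfiable (.and (qi (Q i)) (.and P.trC p.cube.primeSk)) →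
      L = (itp (P.forward (qi (Q i))) p.cube.primeSk).1.unprime →
      ℓ = (abs (skSyms X) L).1 →
      P.QGen (Q i) (ℓ, p.subst) g →
      Step P abs mbp itp (.makeSafe N Q K) (.makeSafe N (Q.insert (i + 1) g) (K \ {p}))
  | blocked {N : ℕ} {Q : Trace X} :
      Step P abs mbp itp (.makeSafe N Q ∅) (.push N Q)
  | push {N : ℕ} {Q : Trace X} {i : ℕ} {l : QLemma X} :
      P.PushRule N Q i l → Step P abs mbp itp (.push N Q) (.push N (Q.insert (i + 1) l))
  | safe {N : ℕ} {Q : Trace X} :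
      (∃ i < N, AllSubset (Q i) (Q (i + 1))) → Step P abs mbp itp (.push N Q) (.safe N)
  | unfold {N : ℕ} {Q : Trace X} :
      (¬ ∃ i < N, AllSubset (Q i) (Q (i + 1))) →
      Step P abs mbp itp (.push N Q) (.makeSafe (N + 1) (Q.clear (N + 1)) {P.badPob (N + 1)})

end Quic3

/-! Soundness. During `MakeSafe` at level `N` the queue has exactly one proof obligation on each of
the levels `i, …, N`. The last is `Bad`, and every state in one obligation has a successor in the
next (`StackInv`). A state in the obligation of level `j` therefore starts a path of `N - j` steps
to a bad state (`StackInv.path`). The frames over-approximate: initial states satisfy every `∀ Q_j`,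
and a transition leads from `∀ Q_j` into `∀ Q_{j+1}` (`TraceInv`). Once `Bad` is blocked at level
`N`, no frame up to `N` has a bad state, so counterexamples are longer than `N`. An obligation of
level `0` contains an initial state, because its model satisfies `Q_0`, which contains `Init`; the
resulting path of length `N` is then shortest. *Safe* would provide an inductive invariant without
bad states and so cannot be returned.

Termination. The solver sees only the ground instances `qi(Q)`, so a quantified lemma alone need not
exclude a model that was found before. What counts is that the instance `ℓξ` stored with a lemma
refutes the very projection `mξ` from which the blocked obligation arose
(`isBlockingLemma_of_qGen`). This rests on deterministic skolemization: `v_i` in `ℓ` and `v_i` in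
`m` come from the same `sk_i`, so `ξ` treats them alike. Projection has finitely many results for a
fixed obligation, and frames only grow; each blocked predecessor thus lowers the number of results
compatible with the frame. Induction on the level, and for each level on this number, shows that
`MakeSafe` terminates (`acc_makeSafe`). `Push` only ever adds parts of lemmas already present
(`acc_push`), and `N` never exceeds the length of a counterexample (`acc_makeSafe_badPob`). -/

namespace Quic3

universe u w

/-! ### Substitution, renaming and the shape of formulas. -/

section SubstitutionLemmas

variable {C : Srt → Type u} {D : Srt → Type w}

/-- The image of a variable under a substitution. -/
def Subst.app (σ : Subst C) (x : Var) : Term C x.1 := (σ x.1 x.2).getD (.var x.1 x.2)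

/-- The valuation that a substitution induces. -/
def Subst.val (σ : Subst C) (M : Interp C) (v : Valuation) : Valuation :=
  fun s n => (σ.app (s, n)).eval M v

theorem Subst.app_some {σ : Subst C} {s : Srt} {n : ℕ} {t : Term C s} (h : σ s n = some t) :
    σ.app (s, n) = t := by
  simp [Subst.app, h]

namespace Term

theorem fvars_rename (f : (s : Srt) → C s → D s) {s : Srt} (t : Term C s) :
    (t.rename f).fvars = t.fvars := by
  induction t <;> simp_all [rename, fvars]

theorem consts_rename (f : (s : Srt) → C s → D s) {s : Srt} (t : Term C s) :
    (t.rename f).consts = (fun c : Sym C => (⟨c.1, f c.1 c.2⟩ : Sym D)) '' t.consts := by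
  induction t <;> simp_all [rename, consts, Set.image_union]

theorem eval_rename (f : (s : Srt) → C s → D s) (M : Interp D) (v : Valuation) {s : Srt}
    (t : Term C s) : (t.rename f).eval M v = t.eval (fun s c => M s (f s c)) v := by
  induction t <;> simp_all [rename, eval]

theorem fvars_subst (σ : Subst C) {s : Srt} (t : Term C s) :
    (t.subst σ).fvars = ⋃ x ∈ t.fvars, (σ.app x).fvars := by
  induction t <;> simp_all [subst, fvars, Subst.app] <;>
    ext <;> simp [or_and_right, exists_or]

theorem consts_subst (σ : Subst C) {s : Srt} (t : Term C s) :
    (t.subst σ).consts = t.consts ∪ ⋃ x ∈ t.fvars, (σ.app x).consts := by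
  induction t <;> simp_all [subst, fvars, consts, Subst.app] <;>
    ext <;> simp [or_and_right, exists_or] <;> refine iff_of_eq ?_ <;> ac_rfl

theorem eval_subst (σ : Subst C) (M : Interp C) (v : Valuation) {s : Srt} (t : Term C s) :
    (t.subst σ).eval M v = t.eval M (σ.val M v) := by
  induction t <;> simp_all [subst, eval, Subst.val, Subst.app]

theorem eval_congr {M M₁ : Interp C} {v v₁ : Valuation} {s : Srt} (t : Term C s)
    (hM : ∀ c ∈ t.consts, M c.1 c.2 = M₁ c.1 c.2) (hv : ∀ x ∈ t.fvars, v x.1 x.2 = v₁ x.1 x.2) :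
    t.eval M v = t.eval M₁ v₁ := by
  induction t <;> simp_all [consts, fvars, eval, or_imp, forall_and]

end Term

namespace Fml

theorem fvars_rename (f : (s : Srt) → C s → D s) (p : Fml C) :
    (p.rename f).fvars = p.fvars := by
  induction p <;> simp_all [rename, fvars, Term.fvars_rename]

theorem Ground.rename {p : Fml C} (h : p.Ground) (f : (s : Srt) → C s → D s) :
    (p.rename f).Ground := by
  rw [Ground, fvars_rename]; exact h

theorem consts_rename (f : (s : Srt) → C s → D s) (p : Fml C) :
    (p.rename f).consts = (fun c : Sym C => (⟨c.1, f c.1 c.2⟩ : Sym D)) '' p.consts := by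
  induction p <;> simp_all [rename, consts, Set.image_union, Term.consts_rename]

theorem holds_rename (f : (s : Srt) → C s → D s) (M : Interp D) (v : Valuation) (p : Fml C) :
    (p.rename f).Holds M v ↔ p.Holds (fun s c => M s (f s c)) v := by
  induction p <;> simp_all [rename, Holds, Term.eval_rename]

theorem fvars_subst (σ : Subst C) (p : Fml C) :
    (p.subst σ).fvars = ⋃ x ∈ p.fvars, (σ.app x).fvars := by
  induction p <;> simp_all [subst, fvars, Term.fvars_subst] <;>
    ext <;> simp [or_and_right, exists_or]

theorem consts_subst (σ : Subst C) (p : Fml C) :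
    (p.subst σ).consts = p.consts ∪ ⋃ x ∈ p.fvars, (σ.app x).consts := by
  induction p <;> simp_all [subst, fvars, consts, Term.consts_subst] <;>
    ext <;> simp [or_and_right, exists_or] <;> refine iff_of_eq ?_ <;> ac_rfl

theorem holds_subst (σ : Subst C) (M : Interp C) (v : Valuation) (p : Fml C) :
    (p.subst σ).Holds M v ↔ p.Holds M (σ.val M v) := by
  induction p <;> simp_all [subst, Holds, Term.eval_subst]

theorem holds_congr {M M₁ : Interp C} {v v₁ : Valuation} (p : Fml C)
    (hM : ∀ c ∈ p.consts, M c.1 c.2 = M₁ c.1 c.2) (hv : ∀ x ∈ p.fvars, v x.1 x.2 = v₁ x.1 x.2) :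
    p.Holds M v ↔ p.Holds M₁ v₁ := by
  induction p with
  | tt => rfl
  | ff => rfl
  | eq a b | lt a b | le a b =>
    simp only [consts, fvars, Set.mem_union, or_imp, forall_and] at hM hv
    simp only [Holds, Term.eval_congr a hM.1 hv.1, Term.eval_congr b hM.2 hv.2]
  | not p ih => simp only [Holds, ih hM hv]
  | and p q ihp ihq | or p q ihp ihq =>
    simp only [consts, fvars, Set.mem_union, or_imp, forall_and] at hM hv
    simp only [Holds, ihp hM.1 hv.1, ihq hM.2 hv.2]

theorem Ground.holds_iff {p : Fml C} (h : p.Ground) {M : Interp C} (v v₁ : Valuation) :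
    p.Holds M v ↔ p.Holds M v₁ :=
  holds_congr p (fun _ _ => rfl) (by rw [show p.fvars = ∅ from h]; simp)

theorem Ground.models_iff {p : Fml C} (h : p.Ground) {M : Interp C} (v : Valuation) :
    Models M p ↔ p.Holds M v :=
  ⟨fun k => k v, fun k v₁ => (h.holds_iff v₁ v).2 k⟩

theorem models_subst {p : Fml C} {M : Interp C} (h : Models M p) (σ : Subst C) :
    Models M (p.subst σ) := fun v => (holds_subst σ M v p).2 (h _)

theorem models_rename (f : (s : Srt) → C s → D s) (M : Interp D) (p : Fml C) :
    Models M (p.rename f) ↔ Models (fun s c => M s (f s c)) p :=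
  forall_congr' fun v => holds_rename f M v p

theorem models_congr {M M₁ : Interp C} (p : Fml C)
    (hM : ∀ c ∈ p.consts, M c.1 c.2 = M₁ c.1 c.2) : Models M p ↔ Models M₁ p :=
  forall_congr' fun _ => holds_congr p hM fun _ _ => rfl

theorem models_and {M : Interp C} {p q : Fml C} :
    Models M (.and p q) ↔ Models M p ∧ Models M q := forall_and

theorem models_conj {M : Interp C} {l : List (Fml C)} :
    Models M (conj l) ↔ ∀ p ∈ l, Models M p := by
  induction l with
  | nil => simp [conj, Models, Holds]
  | cons p l ih => simp [conj, models_and, ih]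

theorem Ground.and {p q : Fml C} (hp : p.Ground) (hq : q.Ground) : (Fml.and p q).Ground := by
  simp_all [Ground, fvars]

theorem Ground.or {p q : Fml C} (hp : p.Ground) (hq : q.Ground) : (Fml.or p q).Ground := by
  simp_all [Ground, fvars]

theorem ground_conj {l : List (Fml C)} (h : ∀ p ∈ l, p.Ground) : (conj l).Ground := by
  induction l with
  | nil => rfl
  | cons p l ih => exact (h p (by simp)).and (ih fun q hq => h q (by simp [hq]))

theorem ground_subst_iff {σ : Subst C} {p : Fml C} :
    (p.subst σ).Ground ↔ ∀ x ∈ p.fvars, (σ.app x).fvars = ∅ := by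
  simp [Ground, fvars_subst]

theorem isAtom_subst_iff (σ : Subst C) (p : Fml C) : (p.subst σ).IsAtom ↔ p.IsAtom := by
  constructor
  · intro h
    cases p <;> first | constructor | (simp only [subst] at h; cases h)
  · rintro (_ | _ | _) <;> constructor

theorem isAtom_rename {f : (s : Srt) → C s → D s} {p : Fml C} (h : p.IsAtom) :
    (p.rename f).IsAtom := by
  cases h <;> constructor

theorem isLiteral_subst_iff (σ : Subst C) (p : Fml C) :
    (p.subst σ).IsLiteral ↔ p.IsLiteral := by
  constructor
  · intro h
    cases p with
    | not p =>
      rcases h with h | h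
      · cases h
      · exact .neg ((isAtom_subst_iff σ p).1 h)
    | _ => 
      cases h
      rename_i h
      exact .pos ((isAtom_subst_iff σ _).1 h)
  · rintro (h | h)
    · exact .pos ((isAtom_subst_iff σ _).2 h)
    · exact .neg ((isAtom_subst_iff σ _).2 h)

theorem IsMonomial.subst {p : Fml C} (h : p.IsMonomial) (σ : Subst C) :
    (p.subst σ).IsMonomial := by
  induction h with
  | tt => exact .tt
  | lit h => exact .lit ((isLiteral_subst_iff σ _).2 h)
  | and _ _ ihp ihq => exact .and ihp ihq

/-- Substitution acts on terms only and keeps the Boolean structure. Projection returns a monomial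
`φ = ψσ`, and the cube of the new obligation is `ψ`. -/
theorem IsMonomial.of_subst {σ : Subst C} {p : Fml C} (h : (p.subst σ).IsMonomial) :
    p.IsMonomial := by
  induction p with
  | tt => exact .tt
  | and p q ihp ihq =>
    rcases h with _ | h | ⟨hp, hq⟩
    · cases h; rename_i h; cases h
    · exact .and (ihp hp) (ihq hq)
  | _ =>
    refine .lit ((isLiteral_subst_iff σ _).1 ?_)
    rcases h with _ | h
    exact h

theorem IsMonomial.rename {p : Fml C} (h : p.IsMonomial) (f : (s : Srt) → C s → D s) :
    (p.rename f).IsMonomial := by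
  induction h with
  | tt => exact .tt
  | lit h =>
    rcases h with h | h
    · exact .lit (.pos (isAtom_rename h))
    · exact .lit (.neg (isAtom_rename h))
  | and _ _ ihp ihq => exact .and ihp ihq

theorem SubDisj.fvars_subset {p q : Fml C} (h : SubDisj p q) : p.fvars ⊆ q.fvars := by
  induction h with
  | refl => exact subset_rfl
  | left _ ih => exact ih.trans Set.subset_union_left
  | right _ ih => exact ih.trans Set.subset_union_right
  | both _ _ ihp ihq => exact Set.union_subset_union ihp ihq

theorem SubDisj.consts_subset {p q : Fml C} (h : SubDisj p q) : p.consts ⊆ q.consts := by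
  induction h with
  | refl => exact subset_rfl
  | left _ ih => exact ih.trans Set.subset_union_left
  | right _ ih => exact ih.trans Set.subset_union_right
  | both _ _ ihp ihq => exact Set.union_subset_union ihp ihq

theorem SubDisj.trans {p q r : Fml C} (h : SubDisj p q) (k : SubDisj q r) : SubDisj p r := by
  induction k generalizing p with
  | refl => exact h
  | left _ ih => exact .left (ih h)
  | right _ ih => exact .right (ih h)
  | both kp kq ihp ihq =>
    rcases h with _ | h | h | ⟨h₁, h₂⟩
    · exact .both kp kq
    · exact .left (ihp h)
    · exact .right (ihq h)
    · exact .both (ihp h₁) (ihq h₂)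

/-- This bounds what `Push` can ever add. -/
theorem finite_subDisj (q : Fml C) : {p | SubDisj p q}.Finite := by
  induction q with
  | or a b iha ihb =>
    refine (((Set.finite_singleton (Fml.or a b)).union (iha.union ihb)).union
      (iha.image2 Fml.or ihb)).subset ?_
    rintro p (_ | h | h | ⟨h₁, h₂⟩)
    · simp
    · simp [show SubDisj p a from h]
    · simp [show SubDisj p b from h]
    · exact Or.inr ⟨_, h₁, _, h₂, rfl⟩
  | _ =>
    apply (Set.finite_singleton _).subset
    rintro p ⟨⟩
    rfl

end Fml

end SubstitutionLemmas


/-! ### States, transitions and counterexamples. -/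

section States

variable {X : Srt → Type u}

/-- The state given by the unprimed constants. -/
def preState (M : Interp (Con X)) : Interp X := fun s a => M s (.base a)

/-- The state given by the primed constants. -/
def postState (M : Interp (Con X)) : Interp X := fun s a => M s (.primed a)

/-- The structure with given pre-state, post-state and values of the Skolem constants. -/
def joinStates (S S₁ : Interp X) (v : Valuation) : Interp (Con X)
  | _, .base a => S _ a
  | _, .primed a => S₁ _ a
  | _, .sk s n => v s n

/-- A valuation. -/
def zeroVal : Valuation
  | .int, _ => (0 : ℤ)
  | .array, _ => fun _ : ℤ => (0 : ℤ)

theorem interp_prime (M : Interp (Con X)) :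
    (fun s c => M s (Con.prime s c)) =
      joinStates (postState M) (postState M) fun s n => M s (.sk s n) := by
  funext s c
  cases c <;> rfl

theorem interp_unprime (M : Interp (Con X)) :
    (fun s c => M s (Con.unprime s c)) =
      joinStates (preState M) (preState M) fun s n => M s (.sk s n) := by
  funext s c
  cases c <;> rfl

/-- The formula contains no uninterpreted constants other than program variables. -/
def OverBase (p : Fml (Con X)) : Prop := p.consts ⊆ baseSyms X

theorem OverBase.holds_iff {p : Fml (Con X)} (h : OverBase p) {M M₁ : Interp (Con X)}
    (hM : preState M = preState M₁) (v : Valuation) : p.Holds M v ↔ p.Holds M₁ v := by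
  refine Fml.holds_congr p (fun c hc => ?_) fun _ _ => rfl
  obtain ⟨s, a, rfl⟩ := h hc
  exact congrFun (congrFun hM s) a

theorem OverBase.models_iff {p : Fml (Con X)} (h : OverBase p) {M M₁ : Interp (Con X)}
    (hM : preState M = preState M₁) : Models M p ↔ Models M₁ p :=
  forall_congr' fun v => h.holds_iff hM v

theorem overBase_rename (p : Fml X) : OverBase (p.rename fun _ a => (Con.base a : Con X _)) := by
  intro c hc
  rw [Fml.consts_rename] at hc
  obtain ⟨a, -, rfl⟩ := hc
  exact ⟨_, _, rfl⟩

/-- The state satisfies `∃ p`. -/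
def ExAt (p : Fml (Con X)) (S : Interp X) : Prop := ∃ M, preState M = S ∧ ModelsEx M p

/-- The state satisfies `∀ p`. -/
def AllAt (p : Fml (Con X)) (S : Interp X) : Prop := ∀ M, preState M = S → Models M p

/-- The state satisfies `∀ Q`. -/
def FrameAt (Q : List (QLemma X)) (S : Interp X) : Prop := ∀ l ∈ Q, AllAt l.1 S

theorem OverBase.allAt {p : Fml (Con X)} (h : OverBase p) {M : Interp (Con X)}
    (hM : Models M p) : AllAt p (preState M) :=
  fun _ h₁ => (h.models_iff h₁).2 hM

theorem OverBase.modelsEx {p : Fml (Con X)} (h : OverBase p) {M : Interp (Con X)}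
    (hM : ExAt p (preState M)) : ModelsEx M p := by
  obtain ⟨M₁, h₁, v, hv⟩ := hM
  exact ⟨v, (h.holds_iff h₁ v).1 hv⟩

theorem models_qi {M : Interp (Con X)} {Q : List (QLemma X)} :
    Models M (qi Q) ↔ ∀ l ∈ Q, Models M (l.1.subst l.2) := by
  simp only [qi, Fml.models_conj, List.forall_mem_map]

/-- The instances may mention primed and Skolem constants. Their values do not matter, since the
state satisfies the quantified lemmas. -/
theorem FrameAt.models_qi {Q : List (QLemma X)} {M : Interp (Con X)}
    (h : FrameAt Q (preState M)) : Models M (qi Q) :=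
  Quic3.models_qi.2 fun l hl => Fml.models_subst (h l hl M rfl) _

theorem ground_qi {Q : List (QLemma X)} (h : ∀ l ∈ Q, (l.1.subst l.2).Ground) :
    (qi Q).Ground :=
  Fml.ground_conj (List.forall_mem_map.2 h)

/-- The Skolem constants serve as values of the variables, so a model of `m'_sk` yields a witness
for `∃ m` in the post-state. -/
theorem holds_primeSk (m : Fml (Con X)) (M : Interp (Con X)) (v : Valuation) :
    m.primeSk.Holds M v ↔
      m.Holds (joinStates (postState M) (postState M) fun s n => M s (.sk s n))
        fun s n => M s (.sk s n) := by
  rw [Fml.primeSk, Fml.prime, Fml.holds_rename, Fml.holds_subst, interp_prime]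
  rfl

theorem Fml.Ground.unprime {p : Fml (Con X)} (h : p.Ground) : p.unprime.Ground := h.rename _

theorem ground_primeSk (m : Fml (Con X)) : m.primeSk.Ground :=
  Fml.Ground.rename (Fml.ground_subst_iff.2 fun _ _ => rfl) _

theorem consts_primeSk {m : Fml (Con X)} (h : OverBase m) :
    m.primeSk.consts ⊆
      {c | ∃ (s : Srt) (a : X s), c = ⟨s, .primed a⟩} ∪
        {c | ∃ x ∈ m.fvars, c = ⟨x.1, .sk x.1 x.2⟩} := by
  intro c hc
  rw [Fml.primeSk, Fml.prime, Fml.consts_rename, Fml.consts_subst] at hc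
  obtain ⟨c, hc | hc, rfl⟩ := hc
  · obtain ⟨s, a, rfl⟩ := h hc
    exact Or.inl ⟨_, _, rfl⟩
  · obtain ⟨x, hx, hc⟩ := Set.mem_iUnion₂.1 hc
    refine Or.inr ⟨x, hx, ?_⟩
    have hc : c = ⟨x.1, .sk x.1 x.2⟩ := hc
    rw [hc]
    rfl

namespace SafetyProblem

variable (P : SafetyProblem X)

/-- Initial states. -/
def IsInit (S : Interp X) : Prop := Models S P.init

/-- Bad states. -/
def IsBad (S : Interp X) : Prop := Models S P.bad

/-- The transition relation on states. -/
def IsStep (S S₁ : Interp X) : Prop :=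
  Models (C := fun s => X s ⊕ X s) (fun s a => Sum.elim (S s) (S₁ s) a) P.tr

theorem models_initC {M : Interp (Con X)} : Models M P.initC ↔ P.IsInit (preState M) :=
  Fml.models_rename _ _ _

theorem models_badC {M : Interp (Con X)} : Models M P.badC ↔ P.IsBad (preState M) :=
  Fml.models_rename _ _ _

theorem models_initC_prime {M : Interp (Con X)} :
    Models M P.initC.prime ↔ P.IsInit (postState M) := by
  rw [Fml.prime, Fml.models_rename, models_initC]
  rfl

theorem models_trC {M : Interp (Con X)} :
    Models M P.trC ↔ P.IsStep (preState M) (postState M) := by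
  rw [trC, Fml.models_rename, IsStep]
  congr! with s a
  cases a <;> rfl

theorem ground_initC : P.initC.Ground := P.init_ground.rename _

theorem ground_trC : P.trC.Ground := P.tr_ground.rename _

theorem ground_badC : P.badC.Ground := P.bad_ground.rename _

theorem overBase_initC : OverBase P.initC := overBase_rename _

theorem overBase_badC : OverBase P.badC := overBase_rename _

theorem exAt_badC {S : Interp X} : ExAt P.badC S ↔ P.IsBad S := by
  constructor
  · rintro ⟨M, rfl, v, hv⟩
    exact P.models_badC.1 ((P.ground_badC.models_iff v).2 hv)
  · intro h
    exact ⟨joinStates S S zeroVal, rfl, zeroVal, (P.models_badC (M := joinStates S S zeroVal)).2 h _⟩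

/-- The state at time `i`. -/
def _root_.Quic3.stateAt (I : Interp (Timed X)) (i : ℕ) : Interp X := fun s a => I s (i, a)

theorem models_bmc {I : Interp (Timed X)} {k : ℕ} :
    Models I (P.bmc k) ↔ P.IsInit (stateAt I 0) ∧
      (∀ i < k, P.IsStep (stateAt I i) (stateAt I (i + 1))) ∧ P.IsBad (stateAt I k) := by
  simp only [bmc, Fml.models_and, Fml.models_conj, Fml.models_rename, List.forall_mem_map,
    List.mem_range]
  refine and_congr Iff.rfl (and_congr (forall₂_congr fun i _ => ?_) Iff.rfl)
  rw [IsStep]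
  congr! with s a
  cases a <;> rfl

theorem models_bmc_of_path {k : ℕ} {π : ℕ → Interp X} (h₀ : P.IsInit (π 0))
    (h : ∀ i < k, P.IsStep (π i) (π (i + 1))) (hk : P.IsBad (π k)) :
    Models (fun s a => π a.1 s a.2) (P.bmc k) :=
  P.models_bmc.2 ⟨h₀, h, hk⟩

theorem satisfiable_initC_badC_iff :
    Satisfiable (.and P.initC P.badC) ↔ P.HasCex 0 := by
  constructor
  · rintro ⟨M, hM⟩
    rw [Fml.models_and, models_initC, models_badC] at hM
    exact ⟨_, P.models_bmc_of_path (π := fun _ => preState M) hM.1 (by simp) hM.2⟩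
  · rintro ⟨I, hI⟩
    obtain ⟨h, -, hb⟩ := P.models_bmc.1 hI
    refine ⟨joinStates (stateAt I 0) (stateAt I 0) zeroVal, ?_⟩
    rw [Fml.models_and, models_initC, models_badC]
    exact ⟨h, hb⟩

end SafetyProblem

end States

/-! ### Abstraction of constants by variables. -/

section Oracles

variable {X : Srt → Type u}
  {abs : Set (Sym (Con X)) → Fml (Con X) → Fml (Con X) × Subst (Con X)}
  {mbp : Set (Sym (Con X)) → Fml (Con X) → Interp (Con X) → Fml (Con X) × Set (Sym (Con X))}
  {itp : Fml (Con X) → Fml (Con X) → Fml (Con X) × Set (Sym (Con X))}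

theorem IsAbs.exists_const (habs : IsAbs abs) {U : Set (Sym (Con X))} {p : Fml (Con X)}
    (hp : p.Ground) {x : Var} (hx : x ∈ (abs U p).1.fvars) :
    ∃ c : Con X x.1, (abs U p).2 x.1 x.2 = some (.const c) ∧ (⟨x.1, c⟩ : Sym (Con X)) ∈ U ∧
      (⟨x.1, c⟩ : Sym (Con X)) ∈ p.consts := by
  have hd : x ∈ (abs U p).2.dom := by
    rw [habs.dom_eq U p hp, show p.fvars = ∅ from hp]
    simpa using hx
  obtain ⟨t, ht⟩ := hd
  obtain ⟨c, rfl, hc⟩ := habs.range U p hp _ _ _ ht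
  refine ⟨c, ht, hc, ?_⟩
  rw [← habs.subst_eq U p hp, Fml.consts_subst]
  refine Or.inr (Set.mem_iUnion₂.2 ⟨x, hx, ?_⟩)
  rw [show (abs U p).2.app x = .const c from Subst.app_some ht]
  rfl

/-- The variable is mapped to some `sk_n`, to which `v_n` is mapped as well; injectivity makes the
two variables equal. -/
theorem IsAbs.skSyms_apply (habs : IsAbs abs) {p : Fml (Con X)}
    (hp : p.Ground) {x : Var} (hx : x ∈ (abs (skSyms X) p).1.fvars) :
    (abs (skSyms X) p).2 x.1 x.2 = some (.const (.sk x.1 x.2)) ∧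
      (⟨x.1, .sk x.1 x.2⟩ : Sym (Con X)) ∈ p.consts := by
  obtain ⟨s, k⟩ := x
  obtain ⟨c, h, hs, hc⟩ := habs.exists_const hp hx
  have hs' := hs
  obtain ⟨r, n, hn⟩ := hs'
  obtain ⟨rfl, hn⟩ := Sigma.mk.inj_iff.1 hn
  cases hn
  have h₁ := habs.skolem _ p hp _ _ ⟨hs, hc⟩
  cases habs.inj _ p hp _ _ _ _ h h₁
  exact ⟨h, hc⟩

theorem IsAbs.consts_subset (habs : IsAbs abs) {U : Set (Sym (Con X))} {p : Fml (Con X)}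
    (hp : p.Ground) : (abs U p).1.consts ⊆ p.consts \ U := by
  intro c hc
  refine ⟨?_, fun hU => (habs.disjoint U p hp).le_bot ⟨hU, hc⟩⟩
  rw [← habs.subst_eq U p hp, Fml.consts_subst]
  exact Or.inl hc

/-- The values of the variables of an abstraction are realized by its constants. -/
theorem IsAbs.realize (habs : IsAbs abs) {U : Set (Sym (Con X))} {p : Fml (Con X)}
    (hp : p.Ground) {M : Interp (Con X)} {v : Valuation} (h : (abs U p).1.Holds M v) :
    ∃ M₁, AgreeOff U M M₁ ∧ Models M₁ p := by
  classical
  -- A constant that replaces a variable receives the value of this variable. By injectivity of the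
  -- substitution the chosen variable is the only candidate.
  let M₁ : Interp (Con X) := fun s c =>
    if h : ∃ n, (abs U p).2 s n = some (.const c) then v s h.choose else M s c
  have hM₁ : AgreeOff U M M₁ := by
    intro s c hc
    refine dif_neg ?_
    rintro ⟨n, hn⟩
    obtain ⟨c₁, h₁, h₂⟩ := habs.range U p hp _ _ _ hn
    cases h₁
    exact hc h₂
  refine ⟨M₁, hM₁, (hp.models_iff v).2 ?_⟩
  rw [← habs.subst_eq U p hp, Fml.holds_subst]
  refine (Fml.holds_congr _ (fun c hc => ?_) fun x hx => ?_).1 h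
  · exact (hM₁ _ _ (habs.consts_subset hp hc).2).symm
  · obtain ⟨c, hc, -⟩ := habs.exists_const hp hx
    have hex : ∃ n, (abs U p).2 x.1 n = some (.const c) := ⟨_, hc⟩
    rw [Subst.val, Subst.app_some hc]
    change v x.1 x.2 = dite _ _ _
    rw [dif_pos hex]
    exact congrArg _ (habs.inj U p hp _ _ _ _ hc hex.choose_spec)

theorem IsAbs.holds_skSyms_iff (habs : IsAbs abs) {p : Fml (Con X)} (hp : p.Ground)
    {M M₁ : Interp (Con X)} {v : Valuation} (hM : AgreeOff (skSyms X) M M₁)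
    (hv : ∀ s n, M₁ s (.sk s n) = v s n) :
    (abs (skSyms X) p).1.Holds M v ↔ Models M₁ p := by
  rw [hp.models_iff v]
  conv_rhs => rw [← habs.subst_eq (skSyms X) p hp]
  rw [Fml.holds_subst]
  refine Fml.holds_congr _ (fun c hc => ?_) fun x hx => ?_
  · exact (hM _ _ (habs.consts_subset hp hc).2).symm
  · rw [Subst.val, Subst.app_some (habs.skSyms_apply hp hx).1]
    exact (hv _ _).symm

/-- The clause obtained from an interpolant over `X' ∪ SK` by dropping the primes and abstracting
the Skolem constants. -/
theorem IsAbs.holds_unprime_iff (habs : IsAbs abs) {p : Fml (Con X)} (hp : p.Ground)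
    (hc : p.consts ⊆ elimSyms X) {M : Interp (Con X)} {v : Valuation} (S : Interp X) :
    (abs (skSyms X) p.unprime).1.Holds M v ↔ Models (joinStates S (preState M) v) p := by
  rw [habs.holds_skSyms_iff hp.unprime (v := v)
    (M₁ := joinStates (preState M) (postState M) v) ?_ fun _ _ => rfl, Fml.unprime, Fml.models_rename, interp_unprime]
  · refine Fml.models_congr _ fun c h => ?_
    rcases hc h with ⟨s, a, rfl⟩ | ⟨s, a, rfl⟩ <;> rfl
  · rintro s (a | a | n) h
    · rfl
    · rfl
    · exact absurd ⟨s, n, rfl⟩ h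

theorem IsAbs.overBase_unprime (habs : IsAbs abs) {p : Fml (Con X)} (hp : p.Ground)
    (hc : p.consts ⊆ elimSyms X) : OverBase (abs (skSyms X) p.unprime).1 := by
  intro c h
  obtain ⟨h₁, h₂⟩ := habs.consts_subset hp.unprime h
  rw [Fml.unprime, Fml.consts_rename] at h₁
  obtain ⟨c, h₁, rfl⟩ := h₁
  rcases hc h₁ with ⟨s, a, rfl⟩ | ⟨s, n, rfl⟩
  · exact ⟨s, a, rfl⟩
  · exact absurd ⟨s, n, rfl⟩ h₂

theorem IsAbs.fvars_unprime (habs : IsAbs abs) {p : Fml (Con X)} (hp : p.Ground)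
    (hc : p.consts ⊆ elimSyms X) {x : Var} (hx : x ∈ (abs (skSyms X) p.unprime).1.fvars) :
    (⟨x.1, .sk x.1 x.2⟩ : Sym (Con X)) ∈ p.consts := by
  have h := (habs.skSyms_apply hp.unprime hx).2
  rw [Fml.unprime, Fml.consts_rename] at h
  obtain ⟨c, h, e⟩ := h
  rcases hc h with ⟨s, a, rfl⟩ | ⟨s, n, rfl⟩
  · obtain ⟨rfl, e⟩ := Sigma.mk.inj_iff.1 e
    cases e
  · change (⟨s, .sk s n⟩ : Sym (Con X)) = _ at e
    rwa [e] at h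

end Oracles


/-! ### The two rules of `MakeSafe`: blocking lemmas and predecessors. -/

section Rules

variable {X : Srt → Type u}
  {abs : Set (Sym (Con X)) → Fml (Con X) → Fml (Con X) × Subst (Con X)}
  {mbp : Set (Sym (Con X)) → Fml (Con X) → Interp (Con X) → Fml (Con X) × Set (Sym (Con X))}
  {itp : Fml (Con X) → Fml (Con X) → Fml (Con X) × Set (Sym (Con X))}
  {P : SafetyProblem X}

/-- Well-formed proof obligations. -/
structure Pob.Wf (p : Pob X) : Prop where
  monomial : p.cube.IsMonomial
  overBase : OverBase p.cube
  ground : (p.cube.subst p.subst).Ground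

/-- The frame refutes the ground instance of the proof obligation. -/
def Blocks (Q : List (QLemma X)) (p : Pob X) : Prop :=
  ∀ M, Models M (qi Q) → ¬ Models M (p.cube.subst p.subst)

/-- Properties of a lemma `g` that blocks the proof obligation `p` one step after `Q`. -/
structure IsBlockingLemma (P : SafetyProblem X) (Q : List (QLemma X)) (p : Pob X) (g : QLemma X) :
    Prop where
  overBase : OverBase g.1
  ground : (g.1.subst g.2).Ground
  init : ∀ S, P.IsInit S → AllAt g.1 S
  step : ∀ S S₁, FrameAt Q S → P.IsStep S S₁ → AllAt g.1 S₁
  refutes : ∀ M, Models M (g.1.subst g.2) → ¬ Models M (p.cube.subst p.subst)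

theorem OverBase.allAt_of_forall {p : Fml (Con X)} {S : Interp X}
    (h : ∀ v, p.Holds (joinStates S S v) v) (hp : OverBase p) : AllAt p S := by
  rintro M rfl v
  exact (hp.holds_iff (by rfl) v).1 (h v)

theorem models_prime {M : Interp (Con X)} {p : Fml (Con X)} (hp : OverBase p)
    (h : Models M p.prime) : AllAt p (postState M) := by
  rw [Fml.prime, Fml.models_rename, interp_prime] at h
  exact hp.allAt h

/-- The values `v` of the Skolem constants are arbitrary. Letting them vary turns a ground
interpolant into a universally quantified lemma about `S₁`. -/
theorem forward_models {Q : List (QLemma X)} {S S₁ : Interp X} (hQ : FrameAt Q S)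
    (h : P.IsStep S S₁) (v : Valuation) : Models (joinStates S S₁ v) (P.forward (qi Q)) := by
  have h₁ : Models (joinStates S S₁ v) (.and (qi Q) P.trC) :=
    Fml.models_and.2 ⟨FrameAt.models_qi (M := joinStates S S₁ v) hQ, P.models_trC.2 h⟩
  exact fun w => Or.inl (h₁ w)

theorem forward_models_init {Q : List (QLemma X)} {S S₁ : Interp X}
    (h : P.IsInit S₁) (v : Valuation) : Models (joinStates S S₁ v) (P.forward (qi Q)) :=
  fun w => Or.inr ((P.models_initC_prime (M := joinStates S S₁ v)).2 h w)

theorem isBlockingLemma_of_qGen (habs : IsAbs abs) (hitp : IsPItp itp) {Q : List (QLemma X)}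
    (hQ : ∀ l ∈ Q, (l.1.subst l.2).Ground) {p : Pob X} (hp : p.Wf)
    (hinit : ∀ S, P.IsInit S → ¬ ExAt p.cube S)
    (hunsat : ¬ Satisfiable (.and (qi Q) (.and P.trC p.cube.primeSk))) {g : QLemma X}
    (hg : P.QGen Q
      ((abs (skSyms X) (itp (P.forward (qi Q)) p.cube.primeSk).1.unprime).1, p.subst) g) :
    IsBlockingLemma P Q p g := by
  set A := P.forward (qi Q) with hA
  set B := p.cube.primeSk with hB
  have hAg : A.Ground :=
    ((ground_qi hQ).and P.ground_trC).or (P.ground_initC.rename _)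
  have hBg : B.Ground := ground_primeSk _
  have hBm : B.IsMonomial := (hp.monomial.subst _).rename _
  have hent : Entails A B.not := by
    intro M hM v hv
    -- The unsatisfiable query excludes the transition disjunct, and `hinit` excludes the disjunct
    -- `Init(X')`.
    rcases hM v with h | h
    · refine hunsat ⟨M, Fml.models_and.2 ⟨((ground_qi hQ).models_iff v).2 h.1,
        Fml.models_and.2 ⟨(P.ground_trC.models_iff v).2 h.2, (hBg.models_iff v).2 hv⟩⟩⟩
    · refine hinit (postState M) (P.models_initC_prime.1
        (((P.ground_initC.rename _).models_iff v).2 h)) ?_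
      exact ⟨_, rfl, _, (holds_primeSk _ _ _).1 hv⟩
  have hIg := hitp.ground A B hAg hBg hBm hent
  have hIB : (itp A B).1.consts ⊆ B.consts := by
    refine (hitp.consts A B hAg hBg hBm hent).trans (Set.union_subset Set.inter_subset_right ?_)
    exact (hitp.subset A B hAg hBg hBm hent).trans Set.sdiff_subset
  have hIc : (itp A B).1.consts ⊆ elimSyms X := by
    refine (hIB.trans (consts_primeSk hp.overBase)).trans (Set.union_subset_union_right _ ?_)
    rintro _ ⟨x, -, rfl⟩
    exact ⟨_, _, rfl⟩
  -- The case `J = I` of `left` is enough, because `forward_models` already allows any Skolem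
  -- values.
  have hAI : ∀ M, Models M A → Models M (itp A B).1 := fun M hM =>
    hitp.left A B hAg hBg hBm hent M M hM fun _ _ _ => rfl
  set ℓ := (abs (skSyms X) (itp A B).1.unprime).1 with hℓ
  have hb : OverBase ℓ := habs.overBase_unprime hIg hIc
  have hiff : ∀ {M : Interp (Con X)} {v : Valuation} (S : Interp X),
      ℓ.Holds M v ↔ Models (joinStates S (preState M) v) (itp A B).1 :=
    fun S => habs.holds_unprime_iff hIg hIc S
  have hfv : ℓ.fvars ⊆ p.cube.fvars := by
    intro x hx
    rcases consts_primeSk hp.overBase (hIB (habs.fvars_unprime hIg hIc hx)) with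
      ⟨s, a, e⟩ | ⟨y, hy, e⟩
    · obtain ⟨rfl, e⟩ := Sigma.mk.inj_iff.1 e
      cases e
    · obtain ⟨s, n⟩ := x
      obtain ⟨r, k⟩ := y
      cases e
      exact hy
  have href : ∀ M, Models M (ℓ.subst p.subst) → ¬ Models M (p.cube.subst p.subst) := by
    intro M h₁ h₂
    -- The valuation induced by `p.subst` gives the Skolem constants their values. In this one
    -- structure both the interpolant and `m'_sk` would hold. The pre-state in it is arbitrary, as
    -- the interpolant lies over `X' ∪ SK`.
    have h₁ := (hiff (preState M)).1 ((Fml.holds_subst _ _ _ _).1 (h₁ zeroVal))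
    have h₂ := (Fml.holds_subst _ _ _ _).1 (h₂ zeroVal)
    refine hitp.right A B hAg hBg hBm hent _ h₁ zeroVal ((holds_primeSk _ _ _).2 ?_)
    exact (hp.overBase.holds_iff (by rfl) _).1 h₂
  rcases hg with rfl | ⟨hgb, hgg, hgl, -, hgA⟩
  · refine ⟨hb, ?_, fun S hS => ?_, fun S S₁ hS h => ?_, href⟩
    · exact Fml.ground_subst_iff.2 fun x hx => Fml.ground_subst_iff.1 hp.ground x (hfv hx)
    · exact hb.allAt_of_forall fun v => (hiff S).2 (hAI _ (forward_models_init hS v))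
    · exact hb.allAt_of_forall fun v => (hiff S).2 (hAI _ (forward_models hS h v))
  · refine ⟨hgb, hgg, fun S hS => ?_, fun S S₁ hS h => ?_, fun M hM => href M ((hgl M).1 hM)⟩
    · exact models_prime hgb (hgA _ (forward_models_init (S := S) hS zeroVal))
    · exact models_prime hgb (hgA _ (forward_models hS h zeroVal))

/-- The proof obligation `q` under-approximates the predecessors of `p`. -/
def IsPred (P : SafetyProblem X) (q p : Pob X) : Prop :=
  ∀ S, ExAt q.cube S → ∃ S₁, P.IsStep S S₁ ∧ ExAt p.cube S₁

theorem pred_of_mbp (habs : IsAbs abs) (hmbp : IsPMbp mbp) {p : Pob X}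
    {M : Interp (Con X)} {T φ ψ : Fml (Con X)} {W : Set (Sym (Con X))} {σ : Subst (Con X)}
    (hT : T = .and P.trC p.cube.primeSk) (hM : Models M T)
    (hφ : (φ, W) = mbp (elimSyms X ∩ T.consts) T M) (hψ : (ψ, σ) = abs W φ) (i : ℕ) :
    Pob.Wf ⟨ψ, σ, i⟩ ∧ IsPred P ⟨ψ, σ, i⟩ p ∧ ψ.subst σ = φ ∧ Models M φ ∧
      ExAt ψ (preState M) := by
  have hTg : T.Ground := hT ▸ P.ground_trC.and (ground_primeSk _)
  have hU : elimSyms X ∩ T.consts ⊆ T.consts := Set.inter_subset_right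
  have hg := hmbp.ground _ T M hTg hU hM
  have hmon := hmbp.monomial _ T M hTg hU hM
  have hW := hmbp.subset _ T M hTg hU hM
  have hc := hmbp.consts _ T M hTg hU hM
  have hund := hmbp.under _ T M hTg hU hM
  have hmod := hmbp.model _ T M hTg hU hM
  rw [← hφ] at hg hmon hW hc hund hmod
  have he : ψ.subst σ = φ := by
    have := habs.subst_eq W φ hg
    rwa [← hψ] at this
  -- A constant of `φ` from `X' ∪ SK` occurs in `T`, so it was to be eliminated and can survive only
  -- in `W`; abstraction then replaces it.
  have hob : OverBase ψ := by
    intro c h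
    have h₁ : c ∈ (abs W φ).1.consts := by rwa [← hψ]
    obtain ⟨h₁, h₂⟩ := habs.consts_subset hg h₁
    obtain ⟨h₃, h₄⟩ := hc h₁
    obtain ⟨s, a | a | n⟩ := c
    · exact ⟨_, _, rfl⟩
    · exact absurd ⟨⟨Or.inl ⟨_, _, rfl⟩, h₃⟩, h₂⟩ h₄
    · exact absurd ⟨⟨Or.inr ⟨_, _, rfl⟩, h₃⟩, h₂⟩ h₄
  refine ⟨⟨(he ▸ hmon : (ψ.subst σ).IsMonomial).of_subst, hob, by
    change (ψ.subst σ).Ground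
    rwa [he]⟩, ?_, he, hmod, M, rfl, ?_⟩
  · rintro S ⟨M₀, rfl, v, hv⟩
    have hv : (abs W φ).1.Holds M₀ v := by rw [← hψ]; exact hv
    obtain ⟨M₁, h₁, hM₁⟩ := habs.realize hg hv
    obtain ⟨M₂, h₂, hM₂⟩ := hund M₁ hM₁
    have hbase : ∀ s (a : X s), (⟨s, .base a⟩ : Sym (Con X)) ∉ elimSyms X := by
      rintro s a (⟨r, b, e⟩ | ⟨r, b, e⟩) <;> obtain ⟨rfl, e⟩ := Sigma.mk.inj_iff.1 e <;> cases e
    -- Realizing `W` and undoing the projection both change constants in `X' ∪ SK` only.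
    have hpre : preState M₂ = preState M₀ := by
      funext s a
      exact (h₂ s _ fun h => hbase s a h.1.1).trans (h₁ s _ fun h => hbase s a (hW h).1)
    rw [hT, Fml.models_and, P.models_trC] at hM₂
    refine ⟨postState M₂, hpre ▸ hM₂.1, ?_⟩
    exact ⟨_, rfl, _, (holds_primeSk _ _ _).1 (hM₂.2 zeroVal)⟩
  · rw [← he] at hmod
    exact ⟨_, (Fml.holds_subst _ _ _ _).1 (hmod zeroVal)⟩

end Rules


/-! ### Invariants of the trace and of the queue. -/

section Invariants

variable {X : Srt → Type u}
  {abs : Set (Sym (Con X)) → Fml (Con X) → Fml (Con X) × Subst (Con X)}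
  {mbp : Set (Sym (Con X)) → Fml (Con X) → Interp (Con X) → Fml (Con X) × Set (Sym (Con X))}
  {itp : Fml (Con X) → Fml (Con X) → Fml (Con X) × Set (Sym (Con X))}
  {P : SafetyProblem X} {N : ℕ} {Q : Trace X}

/-- Invariant of the trace at level `N`. -/
structure TraceInv (P : SafetyProblem X) (N : ℕ) (Q : Trace X) : Prop where
  overBase : ∀ j, ∀ l ∈ Q j, OverBase l.1
  ground : ∀ j, ∀ l ∈ Q j, (l.1.subst l.2).Ground
  init : ∀ j S, P.IsInit S → FrameAt (Q j) S
  step : ∀ j S S₁, FrameAt (Q j) S → P.IsStep S S₁ → FrameAt (Q (j + 1)) S₁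
  mono : ∀ j, Q (j + 1) ⊆ Q j
  zero : (P.initC, Subst.empty) ∈ Q 0
  nil : ∀ j, N < j → Q j = []

theorem traceInv_trace₀ (P : SafetyProblem X) : TraceInv P 0 P.trace₀ where
  overBase j l hl := by
    rcases j with _ | j
    · cases List.mem_singleton.1 hl
      exact P.overBase_initC
    · cases hl
  ground j l hl := by
    rcases j with _ | j
    · cases List.mem_singleton.1 hl
      refine Fml.ground_subst_iff.2 fun x hx => ?_
      rw [show P.initC.fvars = ∅ from P.ground_initC] at hx
      cases hx
    · cases hl
  init j S hS l hl := by
    rcases j with _ | j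
    · cases List.mem_singleton.1 hl
      rintro M rfl
      exact P.models_initC.2 hS
    · cases hl
  step _ _ _ _ _ l hl := by cases hl
  mono _ _ hl := by cases hl
  zero := List.mem_singleton.2 rfl
  nil j hj := if_neg hj.ne'

/-- Frames above `N` are empty already, so clearing changes nothing. -/
theorem TraceInv.clear (h : TraceInv P N Q) : TraceInv P (N + 1) (Q.clear (N + 1)) := by
  have e : Q.clear (N + 1) = Q := by
    rw [Trace.clear, ← h.nil (N + 1) N.lt_succ_self]
    exact Function.update_eq_self _ _
  rw [e]
  exact { h with nil := fun j hj => h.nil j (by omega) }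

theorem TraceInv.antitone (h : TraceInv P N Q) {i j : ℕ} (hij : i ≤ j) : Q j ⊆ Q i := by
  induction hij with
  | refl => exact List.Subset.refl _
  | step _ ih => exact List.Subset.trans (h.mono _) ih

theorem Trace.subset_insert (Q : Trace X) (i : ℕ) (g : QLemma X) (j : ℕ) :
    Q j ⊆ Q.insert i g j := by
  intro l hl
  rw [Trace.insert]
  split_ifs
  · exact List.mem_cons_of_mem _ hl
  · exact hl

theorem Trace.mem_insert {Q : Trace X} {i j : ℕ} {g l : QLemma X} :
    l ∈ Q.insert i g j ↔ (j ≤ i ∧ l = g) ∨ l ∈ Q j := by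
  rw [Trace.insert]
  split_ifs with h <;> simp [h]

theorem FrameAt.of_subset {Q₁ Q₂ : List (QLemma X)} {S : Interp X} (h : FrameAt Q₂ S)
    (hQ : Q₁ ⊆ Q₂) : FrameAt Q₁ S := fun l hl => h l (hQ hl)

/-- `hstep` may assume `g` in the pre-state because `g` also enters all lower frames. `Push` needs
this relative induction; frames `j ≤ i` imply frame `i`, so one hypothesis serves them all. -/
theorem TraceInv.insert (h : TraceInv P N Q) {i : ℕ} (hi : i + 1 ≤ N) {g : QLemma X}
    (hb : OverBase g.1) (hg : (g.1.subst g.2).Ground) (hinit : ∀ S, P.IsInit S → AllAt g.1 S)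
    (hstep : ∀ S S₁, FrameAt (Q i) S → AllAt g.1 S → P.IsStep S S₁ → AllAt g.1 S₁) :
    TraceInv P N (Q.insert (i + 1) g) where
  overBase j l hl := by
    rcases Trace.mem_insert.1 hl with ⟨-, rfl⟩ | hl
    exacts [hb, h.overBase j l hl]
  ground j l hl := by
    rcases Trace.mem_insert.1 hl with ⟨-, rfl⟩ | hl
    exacts [hg, h.ground j l hl]
  init j S hS l hl := by
    rcases Trace.mem_insert.1 hl with ⟨-, rfl⟩ | hl
    exacts [hinit S hS, h.init j S hS l hl]
  step j S S₁ hS hT l hl := by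
    have hS' : FrameAt (Q j) S := hS.of_subset (Trace.subset_insert _ _ _ _)
    rcases Trace.mem_insert.1 hl with ⟨hj, rfl⟩ | hl
    · exact hstep S S₁ (hS'.of_subset (h.antitone (by omega)))
        (hS _ (Trace.mem_insert.2 (Or.inl ⟨by omega, rfl⟩))) hT
    · exact h.step j S S₁ hS' hT l hl
  mono j l hl := by
    rcases Trace.mem_insert.1 hl with ⟨hj, rfl⟩ | hl
    · exact Trace.mem_insert.2 (Or.inl ⟨by omega, rfl⟩)
    · exact Trace.mem_insert.2 (Or.inr (h.mono j hl))
  zero := Trace.mem_insert.2 (Or.inr h.zero)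
  nil j hj := by rw [Trace.insert, if_neg (by omega), h.nil j hj]

theorem TraceInv.frameAt (h : TraceInv P N Q) {k : ℕ} {π : ℕ → Interp X} (h₀ : P.IsInit (π 0))
    (hπ : ∀ i < k, P.IsStep (π i) (π (i + 1))) : ∀ i ≤ k, FrameAt (Q i) (π i) := by
  intro i
  induction i with
  | zero => exact fun _ => h.init 0 _ h₀
  | succ i ih => exact fun hi => h.step i _ _ (ih (by omega)) (hπ i hi)

/-- No frame up to level `N` contains a bad state. -/
def SafeFrames (P : SafetyProblem X) (N : ℕ) (Q : Trace X) : Prop :=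
  ∀ j ≤ N, ∀ S, FrameAt (Q j) S → ¬ P.IsBad S

theorem TraceInv.not_hasCex (h : TraceInv P N Q) (hs : SafeFrames P N Q) {k : ℕ} (hk : k ≤ N) :
    ¬ P.HasCex k := by
  rintro ⟨I, hI⟩
  obtain ⟨h₀, hπ, hb⟩ := P.models_bmc.1 hI
  exact hs k hk _ (h.frameAt h₀ hπ k le_rfl) hb

/-- The frame `∀ Q_i` is closed under transitions, hence an inductive invariant without bad states.
-/
theorem TraceInv.not_hasCex_of_allSubset (h : TraceInv P N Q) (hs : SafeFrames P N Q) {i : ℕ}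
    (hi : i < N) (hsub : AllSubset (Q i) (Q (i + 1))) (k : ℕ) : ¬ P.HasCex k := by
  rintro ⟨I, hI⟩
  obtain ⟨h₀, hπ, hb⟩ := P.models_bmc.1 hI
  have : ∀ j ≤ k, FrameAt (Q i) (stateAt I j) := by
    intro j
    induction j with
    | zero => exact fun _ => h.init i _ h₀
    | succ j ih =>
      intro hj l hl
      obtain ⟨l₁, hl₁, e⟩ := hsub l hl
      exact e ▸ h.step i _ _ (ih (by omega)) (hπ j hj) l₁ hl₁
  exact hs i hi.le _ (this k le_rfl) hb

/-- Invariant of a nonempty or empty queue `{f i, …, f N}` of proof obligations. -/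
structure StackInv (P : SafetyProblem X) (N : ℕ) (f : ℕ → Pob X) (i : ℕ) : Prop where
  le : i ≤ N + 1
  level : ∀ j, i ≤ j → j ≤ N → (f j).level = j
  last : f N = P.badPob N
  wf : ∀ j, i ≤ j → j ≤ N → (f j).Wf
  pred : ∀ j, i ≤ j → j < N → IsPred P (f j) (f (j + 1))
  init : i = 0 → ∃ S, P.IsInit S ∧ ExAt (f 0).cube S

theorem StackInv.path {f : ℕ → Pob X} {i : ℕ} (h : StackInv P N f i) :
    ∀ (d j : ℕ) (S : Interp X), j + d = N → i ≤ j → ExAt (f j).cube S →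
      ∃ π : ℕ → Interp X, π 0 = S ∧ (∀ t < d, P.IsStep (π t) (π (t + 1))) ∧
        (∀ t ≤ d, ExAt (f (j + t)).cube (π t)) ∧ P.IsBad (π d) := by
  intro d
  induction d with
  | zero =>
    rintro j S rfl hj hS
    refine ⟨fun _ => S, rfl, by simp, ?_, ?_⟩
    · intro t ht
      cases Nat.le_zero.1 ht
      exact hS
    · have e : f j = P.badPob j := h.last
      rw [e] at hS
      exact P.exAt_badC.1 hS
  | succ d ih =>
    intro j S hN hj hS
    obtain ⟨S₁, h₁, hS₁⟩ := h.pred j hj (by omega) S hS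
    obtain ⟨π, rfl, hπ, hex, hb⟩ := ih (j + 1) S₁ (by omega) (by omega) hS₁
    refine ⟨fun t => Nat.casesOn t S π, rfl, ?_, ?_, hb⟩
    · rintro (_ | t) ht
      · exact h₁
      · exact hπ t (by omega)
    · rintro (_ | t) ht
      · exact hS
      · rw [show j + (t + 1) = j + 1 + t by omega]
        exact hex t (by omega)

/-- Invariant of `MakeSafe` at level `N`, with queue `{f i, …, f N}`. -/
structure MakeSafeInv (P : SafetyProblem X) (N : ℕ) (Q : Trace X) (f : ℕ → Pob X) (i : ℕ) :
    Prop where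
  pos : 0 < N
  trace : TraceInv P N Q
  stack : StackInv P N f i
  noCex : ∀ k < N, ¬ P.HasCex k
  safe : i = N + 1 → SafeFrames P N Q

theorem badPob_wf (hbad : P.bad.IsMonomial) (N : ℕ) : (P.badPob N).Wf where
  monomial := hbad.rename _
  overBase := P.overBase_badC
  ground := by
    refine Fml.ground_subst_iff.2 fun x hx => ?_
    rw [show (P.badPob N).cube.fvars = ∅ from P.ground_badC] at hx
    cases hx

theorem makeSafeInv_start (hbad : P.bad.IsMonomial) (hN : 0 < N) (hQ : TraceInv P N Q)
    (hc : ∀ k < N, ¬ P.HasCex k) : MakeSafeInv P N Q (fun _ => P.badPob N) N where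
  pos := hN
  trace := hQ
  stack :=
    { le := by omega
      level := fun j h₁ h₂ => le_antisymm h₁ h₂
      last := rfl
      wf := fun _ _ _ => badPob_wf hbad N
      pred := fun j h₁ h₂ => by omega
      init := fun h => by omega }
  noCex := hc
  safe h := by omega

namespace MakeSafeInv

variable {f : ℕ → Pob X} {i : ℕ}

/-- Otherwise the queue would give a counterexample of length `N - (i + 1) < N`. -/
theorem not_exAt_of_isInit (h : MakeSafeInv P N Q f (i + 1)) (hi : i + 1 ≤ N) {S : Interp X}
    (hS : P.IsInit S) : ¬ ExAt (f (i + 1)).cube S := by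
  intro hex
  obtain ⟨π, rfl, hπ, -, hb⟩ := h.stack.path (N - (i + 1)) (i + 1) S (by omega) le_rfl hex
  exact h.noCex (N - (i + 1)) (by omega) ⟨_, P.models_bmc_of_path hS hπ hb⟩

theorem predecessor (h : MakeSafeInv P N Q f (i + 1)) (hi : i + 1 ≤ N) {q : Pob X}
    {M : Interp (Con X)} (hM : Models M (qi (Q i))) (hl : q.level = i) (hq : q.Wf)
    (hp : IsPred P q (f (i + 1))) (hex : ExAt q.cube (preState M)) :
    MakeSafeInv P N Q (Function.update f i q) i where
  pos := h.pos
  trace := h.trace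
  stack :=
    { le := by omega
      level := fun j h₁ h₂ => by
        rcases h₁.eq_or_lt with rfl | h₁
        · simpa using hl
        · rw [Function.update_of_ne h₁.ne']
          exact h.stack.level j h₁ h₂
      last := by
        rw [Function.update_of_ne (by omega)]
        exact h.stack.last
      wf := fun j h₁ h₂ => by
        rcases h₁.eq_or_lt with rfl | h₁
        · simpa using hq
        · rw [Function.update_of_ne h₁.ne']
          exact h.stack.wf j h₁ h₂
      pred := fun j h₁ h₂ => by
        rw [Function.update_of_ne (show j + 1 ≠ i by omega)]
        rcases h₁.eq_or_lt with rfl | h₁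
        · simpa using hp
        · rw [Function.update_of_ne h₁.ne']
          exact h.stack.pred j h₁ h₂
      init := by
        rintro rfl
        refine ⟨preState M, ?_, by simpa using hex⟩
        -- `Q_0` keeps `Init` with the empty substitution, so the model of `qi(Q_0)` has an initial
        -- pre-state.
        refine P.models_initC.1 ((P.ground_initC.models_iff (Subst.empty.val M zeroVal)).2 ?_)
        exact (Fml.holds_subst Subst.empty M zeroVal _).1 (models_qi.1 hM _ h.trace.zero zeroVal) }
  noCex := h.noCex
  safe h := by omega

theorem newLemma (h : MakeSafeInv P N Q f (i + 1)) (hi : i + 1 ≤ N) {g : QLemma X}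
    (hg : IsBlockingLemma P (Q i) (f (i + 1)) g) :
    MakeSafeInv P N (Q.insert (i + 1) g) f (i + 2) where
  pos := h.pos
  trace := h.trace.insert hi hg.overBase hg.ground hg.init fun S S₁ h₁ _ h₂ => hg.step S S₁ h₁ h₂
  stack :=
    { le := by omega
      level := fun j h₁ h₂ => h.stack.level j (by omega) h₂
      last := h.stack.last
      wf := fun j h₁ h₂ => h.stack.wf j (by omega) h₂
      pred := fun j h₁ h₂ => h.stack.pred j (by omega) h₂
      init := fun h => by omega }
  noCex := h.noCex
  safe hN := by
    -- The blocked obligation is `Bad` itself, and `g` was added to every frame up to `N`.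
    obtain rfl : i + 1 = N := by omega
    intro j hj S hS hb
    have h₁ := hS g (Trace.mem_insert.2 (Or.inl ⟨hj, rfl⟩)) (joinStates S S zeroVal) rfl
    refine hg.refutes _ (Fml.models_subst h₁ _) (Fml.models_subst ?_ _)
    rw [h.stack.last]
    exact (P.models_badC (M := joinStates S S zeroVal)).2 hb

theorem eq_of_isTop (h : MakeSafeInv P N Q f i) {p : Pob X} (hp : IsTop p (f '' Set.Icc i N)) :
    i ≤ N ∧ p = f i := by
  obtain ⟨⟨j, ⟨h₁, h₂⟩, rfl⟩, hmin⟩ := hp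
  have hi : i ≤ N := h₁.trans h₂
  have := hmin _ ⟨i, ⟨le_rfl, hi⟩, rfl⟩
  rw [h.stack.level j h₁ h₂, h.stack.level i le_rfl hi] at this
  exact ⟨hi, by rw [le_antisymm this h₁]⟩

theorem image_diff (h : MakeSafeInv P N Q f i) (hi : i ≤ N) :
    f '' Set.Icc i N \ {f i} = f '' Set.Icc (i + 1) N := by
  ext p
  constructor
  · rintro ⟨⟨j, ⟨h₁, h₂⟩, rfl⟩, hne⟩
    refine ⟨j, ⟨Nat.lt_of_le_of_ne h₁ ?_, h₂⟩, rfl⟩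
    rintro rfl
    exact hne rfl
  · rintro ⟨j, ⟨h₁, h₂⟩, rfl⟩
    refine ⟨⟨j, ⟨by omega, h₂⟩, rfl⟩, fun e => ?_⟩
    have e := congrArg Pob.level (Set.mem_singleton_iff.1 e)
    rw [h.stack.level j (by omega) h₂, h.stack.level i le_rfl hi] at e
    omega

end MakeSafeInv

theorem image_update_Icc (f : ℕ → Pob X) (i N : ℕ) (q : Pob X) :
    Function.update f i q '' Set.Icc (i + 1) N = f '' Set.Icc (i + 1) N :=
  Set.image_congr fun j hj => Function.update_of_ne (by have := hj.1; omega) _ _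

theorem insert_image_Icc (f : ℕ → Pob X) {i N : ℕ} (hi : i ≤ N) (q : Pob X) :
    insert q (f '' Set.Icc (i + 1) N) = Function.update f i q '' Set.Icc i N := by
  rw [← image_update_Icc f i N q, ← Set.insert_Icc_succ_left_eq_Icc hi, Set.image_insert_eq,
    Function.update_self]
  rfl

/-- The possible results of model based projection for the predecessors of a proof obligation. -/
def mbpResults (P : SafetyProblem X)
    (mbp : Set (Sym (Con X)) → Fml (Con X) → Interp (Con X) → Fml (Con X) × Set (Sym (Con X)))
    (p : Pob X) : Set (Fml (Con X) × Set (Sym (Con X))) :=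
  {r | ∃ M, Models M (.and P.trC p.cube.primeSk) ∧
    r = mbp (elimSyms X ∩ (Fml.and P.trC p.cube.primeSk).consts) (.and P.trC p.cube.primeSk) M}

theorem finite_mbpResults (hmbp : IsPMbp mbp) (p : Pob X) : (mbpResults P mbp p).Finite :=
  hmbp.finite_range _ _ (P.ground_trC.and (ground_primeSk _)) Set.inter_subset_right

/-- The results of model based projection that a frame does not exclude. -/
def openResults (P : SafetyProblem X)
    (mbp : Set (Sym (Con X)) → Fml (Con X) → Interp (Con X) → Fml (Con X) × Set (Sym (Con X)))
    (p : Pob X) (Q : List (QLemma X)) : Set (Fml (Con X) × Set (Sym (Con X))) :=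
  {r ∈ mbpResults P mbp p | ∃ M, Models M (qi Q) ∧ Models M r.1}

theorem models_qi_of_subset {Q₁ Q₂ : List (QLemma X)} (h : Q₁ ⊆ Q₂) {M : Interp (Con X)}
    (hM : Models M (qi Q₂)) : Models M (qi Q₁) :=
  models_qi.2 fun l hl => models_qi.1 hM l (h hl)

theorem openResults_subset {p : Pob X} {Q₁ Q₂ : List (QLemma X)} (h : Q₁ ⊆ Q₂) :
    openResults P mbp p Q₂ ⊆ openResults P mbp p Q₁ :=
  fun _ ⟨hr, M, hM, hrM⟩ => ⟨hr, M, models_qi_of_subset h hM, hrM⟩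

/-- The outcomes of a step of `MakeSafe` from the queue `{f i, …, f N}`. -/
inductive MakeSafeStep (P : SafetyProblem X)
    (mbp : Set (Sym (Con X)) → Fml (Con X) → Interp (Con X) → Fml (Con X) × Set (Sym (Con X)))
    (N : ℕ) (Q : Trace X) (f : ℕ → Pob X) : ℕ → Cfg X → Prop
  | cex : MakeSafeStep P mbp N Q f 0 (.cex N (f '' Set.Icc 0 N))
  | predecessor {i : ℕ} {q : Pob X} {r : Fml (Con X) × Set (Sym (Con X))} : i + 1 ≤ N →
      r ∈ openResults P mbp (f (i + 1)) (Q i) → q.cube.subst q.subst = r.1 →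
      MakeSafeInv P N Q (Function.update f i q) i →
      MakeSafeStep P mbp N Q f (i + 1) (.makeSafe N Q (Function.update f i q '' Set.Icc i N))
  | newLemma {i : ℕ} {Q₁ : Trace X} : i ≤ N → (∀ j, Q j ⊆ Q₁ j) →
      MakeSafeInv P N Q₁ f (i + 1) → Blocks (Q₁ i) (f i) →
      MakeSafeStep P mbp N Q f i (.makeSafe N Q₁ (f '' Set.Icc (i + 1) N))
  | blocked : MakeSafeStep P mbp N Q f (N + 1) (.push N Q)

theorem MakeSafeInv.makeSafeStep (habs : IsAbs abs) (hmbp : IsPMbp mbp) (hitp : IsPItp itp)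
    {f : ℕ → Pob X} {i : ℕ} (h : MakeSafeInv P N Q f i) {d : Cfg X}
    (hd : Step P abs mbp itp (.makeSafe N Q (f '' Set.Icc i N)) d) :
    MakeSafeStep P mbp N Q f i d := by
  generalize hK : f '' Set.Icc i N = K at hd
  cases hd with
  | cex hp h₀ =>
    subst hK
    obtain ⟨hi, rfl⟩ := h.eq_of_isTop hp
    rw [h.stack.level i le_rfl hi] at h₀
    subst h₀
    exact .cex
  | @predecessor _ _ _ p i₁ M T φ ψ W σ hp hl hM hT hφ hψ =>
    subst hK
    obtain ⟨hi, rfl⟩ := h.eq_of_isTop hp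
    rw [h.stack.level i le_rfl hi] at hl
    subst hl
    obtain ⟨hMQ, hMT⟩ := Fml.models_and.1 hM
    rw [← hT] at hMT
    obtain ⟨hwf, hpred, he, hmod, hex⟩ := pred_of_mbp habs hmbp hT hMT hφ hψ i₁
    rw [insert_image_Icc f (by omega)]
    refine .predecessor hi (r := (φ, W)) ⟨⟨M, ?_, ?_⟩, M, hMQ, hmod⟩ he
      (h.predecessor hi hMQ rfl hwf hpred hex)
    · rwa [← hT]
    · rw [← hT]; exact hφ
  | @newLemma _ _ _ p i₁ L ℓ g hp hl hM hL hℓ hg =>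
    subst hK
    obtain ⟨hi, rfl⟩ := h.eq_of_isTop hp
    rw [h.stack.level i le_rfl hi] at hl
    subst hl hℓ hL
    have hb := isBlockingLemma_of_qGen habs hitp (h.trace.ground i₁)
      (h.stack.wf _ le_rfl hi) (fun S hS => h.not_exAt_of_isInit hi hS) hM hg
    rw [h.image_diff hi]
    refine .newLemma hi (Trace.subset_insert _ _ _) (h.newLemma hi hb) fun M hM => ?_
    exact hb.refutes M (models_qi.1 hM g (Trace.mem_insert.2 (Or.inl ⟨le_rfl, rfl⟩)))
  | blocked =>
    have hi : ¬ i ≤ N := fun hi => Set.eq_empty_iff_forall_notMem.1 hK (f i) ⟨i, ⟨le_rfl, hi⟩, rfl⟩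
    obtain rfl : i = N + 1 := by have := h.stack.le; omega
    exact .blocked

end Invariants


/-! ### Termination by accessibility of the step relation. -/

section Termination

variable {X : Srt → Type u}
  {abs : Set (Sym (Con X)) → Fml (Con X) → Fml (Con X) × Subst (Con X)}
  {mbp : Set (Sym (Con X)) → Fml (Con X) → Interp (Con X) → Fml (Con X) × Set (Sym (Con X))}
  {itp : Fml (Con X) → Fml (Con X) → Fml (Con X) × Set (Sym (Con X))}
  {P : SafetyProblem X} {N : ℕ} {Q : Trace X}

/-- Invariant of `Push` at level `N`. -/
structure PushInv (P : SafetyProblem X) (N : ℕ) (Q : Trace X) : Prop where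
  pos : 0 < N
  trace : TraceInv P N Q
  safe : SafeFrames P N Q

theorem MakeSafeInv.pushInv {f : ℕ → Pob X} (h : MakeSafeInv P N Q f (N + 1)) : PushInv P N Q :=
  ⟨h.pos, h.trace, h.safe rfl⟩

theorem PushInv.insert (h : PushInv P N Q) {i : ℕ} {l : QLemma X} (hl : P.PushRule N Q i l) :
    PushInv P N (Q.insert (i + 1) l) where
  pos := h.pos
  trace := by
    obtain ⟨hi, ⟨d, hd, hsub⟩, -, hinit, hstep⟩ := hl
    have hb : OverBase l.1 := hsub.consts_subset.trans (h.trace.overBase i _ hd)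
    refine h.trace.insert hi hb ?_ (fun S hS => ?_) fun S S₁ hS hlS hT => ?_
    · exact Fml.ground_subst_iff.2 fun x hx =>
        Fml.ground_subst_iff.1 (h.trace.ground i _ hd) x (hsub.fvars_subset hx)
    · exact hb.allAt (hinit (joinStates S S zeroVal) (P.models_initC.2 hS))
    · exact models_prime hb (hstep (joinStates S S₁ zeroVal) (hlS _ rfl)
        (fun k hk => hS k hk _ rfl) (FrameAt.models_qi (M := joinStates S S₁ zeroVal) hS)
        (P.models_trC.2 hT))
  safe j hj S hS := h.safe j hj S (hS.of_subset (Trace.subset_insert _ _ _ _))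

theorem PushInv.makeSafeInv (h : PushInv P N Q) (hbad : P.bad.IsMonomial) :
    MakeSafeInv P (N + 1) (Q.clear (N + 1)) (fun _ => P.badPob (N + 1)) (N + 1) :=
  makeSafeInv_start hbad N.succ_pos h.trace.clear
    fun _ hk => h.trace.not_hasCex h.safe (Nat.lt_succ_iff.1 hk)

theorem makeSafeInv_one (hbad : P.bad.IsMonomial)
    (h : ¬ Satisfiable (.and P.initC P.badC)) :
    MakeSafeInv P 1 (P.trace₀.clear 1) (fun _ => P.badPob 1) 1 := by
  refine makeSafeInv_start hbad one_pos (traceInv_trace₀ P).clear fun k hk => ?_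
  obtain rfl : k = 0 := by omega
  rwa [← P.satisfiable_initC_badC_iff]

theorem image_const_Icc (q : Pob X) (N : ℕ) : (fun _ => q) '' Set.Icc N N = {q} := by
  simp

theorem acc_cex {K : Set (Pob X)} : Acc (fun d c => Step P abs mbp itp c d) (.cex N K) :=
  ⟨_, fun _ h => by cases h⟩

theorem acc_safe : Acc (fun d c => Step P abs mbp itp c d) (.safe N) :=
  ⟨_, fun _ h => by cases h⟩

/-- `MakeSafe` terminates if it does so from all configurations in which the proof obligation of
least level has been blocked. -/
theorem acc_makeSafe (habs : IsAbs abs) (hmbp : IsPMbp mbp) (hitp : IsPItp itp) :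
    ∀ (i : ℕ) (Q : Trace X) (f : ℕ → Pob X), MakeSafeInv P N Q f i → i ≤ N →
      (∀ Q₁ : Trace X, (∀ j, Q j ⊆ Q₁ j) → MakeSafeInv P N Q₁ f (i + 1) → Blocks (Q₁ i) (f i) →
        Acc (fun d c => Step P abs mbp itp c d) (.makeSafe N Q₁ (f '' Set.Icc (i + 1) N))) →
      Acc (fun d c => Step P abs mbp itp c d) (.makeSafe N Q (f '' Set.Icc i N)) := by
  intro i
  induction i with
  | zero =>
    intro Q f h hi hacc
    refine ⟨_, fun d hd => ?_⟩
    cases h.makeSafeStep habs hmbp hitp hd with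
    | cex => exact acc_cex
    -- `MakeSafeStep` does not rule out blocking at level `0`; the hypothesis covers it.
    | newLemma _ hQ h₁ hb => exact hacc _ hQ h₁ hb
  | succ i ih =>
    intro Q f h hi hacc
    have hfin : ∀ Q : Trace X, (openResults P mbp (f (i + 1)) (Q i)).Finite := fun Q =>
      (finite_mbpResults hmbp _).subset (Set.sep_subset _ _)
    -- The obligation `f (i + 1)` stays fixed while its predecessors are tried and blocked one after
    -- another.
    induction hn : (openResults P mbp (f (i + 1)) (Q i)).ncard using Nat.strong_induction_on
      generalizing Q with
    | _ n ihn =>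
      subst hn
      refine ⟨_, fun d hd => ?_⟩
      cases h.makeSafeStep habs hmbp hitp hd with
      | blocked => omega
      | newLemma _ hQ h₁ hb => exact hacc _ hQ h₁ hb
      | @predecessor _ q r _ hr hq h₁ =>
        refine ih Q _ h₁ (by omega) fun Q₁ hQ₁ h₂ hb => ?_
        rw [image_update_Icc]
        rw [Function.update_self] at hb
        refine ihn _ (Set.ncard_lt_ncard ?_ (hfin Q)) Q₁ ⟨h.pos, h₂.trace, h.stack, h.noCex, ?_⟩
          (fun Q₂ hQ₂ => hacc Q₂ fun j => List.Subset.trans (hQ₁ j) (hQ₂ j)) rfl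
        -- The result `r` was open for `Q i`, but the frame `Q₁ i` refutes it, as it is the ground
        -- instance of the blocked `q`.
        · refine ⟨openResults_subset (hQ₁ i), fun hsub => ?_⟩
          obtain ⟨-, M, hM, hrM⟩ := hsub hr
          exact hb M hM (hq ▸ hrM)
        · intro e
          omega

/-- The pairs of a frame number up to `N` and a lemma from `F` that is missing in this frame. -/
def missing (N : ℕ) (F : Set (QLemma X)) (Q : Trace X) : Set (ℕ × QLemma X) :=
  {x | x ∈ Set.Iic N ×ˢ F ∧ x.2 ∉ Q x.1}

/-- Every application of the rule fills a missing pair, namely `(i + 1, l)`, and `F` bounds the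
number of such pairs. -/
theorem acc_push {F : Set (QLemma X)} (hF : F.Finite)
    (hsub : ∀ p d σ, Fml.SubDisj p d → (d, σ) ∈ F → (p, σ) ∈ F)
    (hacc : ∀ Q : Trace X, PushInv P N Q → Acc (fun d c => Step P abs mbp itp c d)
      (.makeSafe (N + 1) (Q.clear (N + 1)) {P.badPob (N + 1)})) :
    ∀ Q : Trace X, PushInv P N Q → (∀ l ∈ Q 0, l ∈ F) →
      Acc (fun d c => Step P abs mbp itp c d) (.push N Q) := by
  intro Q
  have hfin : ∀ Q : Trace X, (missing N F Q).Finite := fun Q =>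
    ((Set.finite_Iic N).prod hF).subset (Set.sep_subset _ _)
  induction hn : (missing N F Q).ncard using Nat.strong_induction_on generalizing Q with
  | _ n ih =>
    subst hn
    intro h hQ
    refine ⟨_, fun d hd => ?_⟩
    cases hd with
    | @push _ _ i l hl =>
      obtain ⟨hi, ⟨d, hd, hs⟩, hnot, -⟩ := id hl
      -- The frames decrease, so each lemma of `Q i` is also in `Q 0`.
      have hlF : l ∈ F := hsub l.1 d l.2 hs (hQ _ (h.trace.antitone (Nat.zero_le i) hd))
      refine ih _ (Set.ncard_lt_ncard ?_ (hfin Q)) _ rfl (h.insert hl) ?_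
      · refine ⟨fun x hx => ⟨hx.1, fun hm => hx.2 (Trace.subset_insert _ _ _ _ hm)⟩,
          fun hsub => ?_⟩
        have hm : ((i + 1, l) : ℕ × QLemma X) ∈ missing N F Q := ⟨⟨hi, hlF⟩, hnot⟩
        exact (hsub hm).2 (Trace.mem_insert.2 (Or.inl ⟨le_rfl, rfl⟩))
      · intro k hk
        rcases Trace.mem_insert.1 hk with ⟨-, rfl⟩ | hk
        exacts [hlF, hQ k hk]
    | safe => exact acc_safe
    | unfold => exact hacc Q h

theorem acc_push_of_forall
    (hacc : ∀ Q : Trace X, PushInv P N Q → Acc (fun d c => Step P abs mbp itp c d)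
      (.makeSafe (N + 1) (Q.clear (N + 1)) {P.badPob (N + 1)})) (h : PushInv P N Q) :
    Acc (fun d c => Step P abs mbp itp c d) (.push N Q) := by
  refine acc_push (F := ⋃ l ∈ {l | l ∈ Q 0}, (fun p => (p, l.2)) '' {p | Fml.SubDisj p l.1})
    ((List.finite_toSet (Q 0)).biUnion fun l _ => (Fml.finite_subDisj _).image _) ?_ hacc Q h ?_
  · intro p d σ hpd hd
    simp only [Set.mem_iUnion] at hd ⊢
    obtain ⟨l, hl, d, hdl, e⟩ := hd
    cases e
    exact ⟨l, hl, p, hpd.trans hdl, rfl⟩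
  · intro l hl
    exact Set.mem_iUnion₂.2 ⟨l, hl, l.1, .refl _, rfl⟩

/-- The number `n` bounds how often the level can still grow: for `N > k` the invariant contradicts
the counterexample of length `k`. -/
theorem acc_makeSafe_badPob (habs : IsAbs abs) (hmbp : IsPMbp mbp) (hitp : IsPItp itp)
    (hbad : P.bad.IsMonomial) {k : ℕ} (hk : P.HasCex k) :
    ∀ (n N : ℕ), k < N + n → ∀ Q : Trace X, MakeSafeInv P N Q (fun _ => P.badPob N) N →
      Acc (fun d c => Step P abs mbp itp c d) (.makeSafe N Q {P.badPob N}) := by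
  intro n
  induction n with
  | zero => exact fun N hN Q h => absurd hk (h.noCex k hN)
  | succ n ih =>
    intro N hN Q h
    rw [← image_const_Icc (P.badPob N) N]
    refine acc_makeSafe habs hmbp hitp N Q _ h le_rfl fun Q₁ _ h₁ _ => ?_
    refine ⟨_, fun d hd => ?_⟩
    -- With `Bad` blocked the queue is empty, and only `Push` can follow.
    cases h₁.makeSafeStep habs hmbp hitp hd with
    | predecessor => omega
    | newLemma => omega
    | blocked =>
      exact acc_push_of_forall (fun Q₂ h₂ => ih (N + 1) (by omega) _ (h₂.makeSafeInv hbad))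
        h₁.pushInv

theorem acc_start (habs : IsAbs abs) (hmbp : IsPMbp mbp) (hitp : IsPItp itp)
    (hbad : P.bad.IsMonomial) {k : ℕ} (hk : P.HasCex k) :
    Acc (fun d c => Step P abs mbp itp c d) .start := by
  refine ⟨_, fun d hd => ?_⟩
  cases hd with
  | startCex => exact acc_cex
  | startLoop h =>
    exact acc_makeSafe_badPob habs hmbp hitp hbad hk k 1 (by omega) _ (makeSafeInv_one hbad h)

theorem not_exists_infinite_of_acc {α : Type*} {r : α → α → Prop} {a : α}
    (h : Acc (fun d c => r c d) a) : ¬ ∃ c : ℕ → α, c 0 = a ∧ ∀ n, r (c n) (c (n + 1)) := by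
  induction h with
  | intro a _ ih =>
    rintro ⟨c, rfl, hc⟩
    exact ih (c 1) (hc 0) ⟨fun n => c (n + 1), rfl, fun n => hc (n + 1)⟩

end Termination

/-! ### Correctness of the returned result. -/

section Correctness

variable {X : Srt → Type u}
  {abs : Set (Sym (Con X)) → Fml (Con X) → Fml (Con X) × Subst (Con X)}
  {mbp : Set (Sym (Con X)) → Fml (Con X) → Interp (Con X) → Fml (Con X) × Set (Sym (Con X))}
  {itp : Fml (Con X) → Fml (Con X) → Fml (Con X) × Set (Sym (Con X))}
  {P : SafetyProblem X} {N : ℕ} {Q : Trace X}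

/-- A shortest counterexample, of length `N`, that runs through the proof obligations in `K`. -/
def ShortestCex (P : SafetyProblem X) (N : ℕ) (K : Set (Pob X)) : Prop :=
  IsLeast {k | P.HasCex k} N ∧ (0 < N → ∀ j ≤ N, ∃ p ∈ K, p.level = j) ∧
    ∃ I : Interp (Timed X), Models I (P.bmc N) ∧
      ∀ p ∈ K, ∀ M : Interp (Con X),
        (∀ s (a : X s), M s (.base a) = I s (p.level, a)) → ModelsEx M p.cube

/-- The path starts from an initial state in the obligation of level `0`; minimality is the
invariant `noCex`. -/
theorem MakeSafeInv.shortestCex {f : ℕ → Pob X} (h : MakeSafeInv P N Q f 0) :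
    ShortestCex P N (f '' Set.Icc 0 N) := by
  obtain ⟨S, hS, hex⟩ := h.stack.init rfl
  obtain ⟨π, rfl, hπ, hpob, hb⟩ := h.stack.path N 0 S (by omega) le_rfl hex
  have hI := P.models_bmc_of_path hS hπ hb
  refine ⟨⟨⟨_, hI⟩, fun k hk => le_of_not_gt fun hlt => h.noCex k hlt hk⟩, fun _ j hj => ?_,
    _, hI, ?_⟩
  · exact ⟨f j, ⟨j, ⟨Nat.zero_le j, hj⟩, rfl⟩, h.stack.level j (Nat.zero_le j) hj⟩
  · rintro _ ⟨j, ⟨h₀, hj⟩, rfl⟩ M hM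
    refine (h.stack.wf j h₀ hj).overBase.modelsEx ?_
    have e : preState M = π j := by
      funext s a
      exact (hM s a).trans (by rw [h.stack.level j h₀ hj])
    rw [e]
    simpa using hpob j hj

/-- Invariant of the configurations. -/
def CfgInv (P : SafetyProblem X) : Cfg X → Prop
  | .start => True
  | .makeSafe N Q K => ∃ f i, K = f '' Set.Icc i N ∧ MakeSafeInv P N Q f i
  | .push N Q => PushInv P N Q
  | .cex N K => ShortestCex P N K
  | .safe _ => ∀ k, ¬ P.HasCex k

theorem CfgInv.step (habs : IsAbs abs) (hmbp : IsPMbp mbp) (hitp : IsPItp itp)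
    (hbad : P.bad.IsMonomial) {c d : Cfg X} (hc : CfgInv P c) (h : Step P abs mbp itp c d) :
    CfgInv P d := by
  cases c with
  | start =>
    cases h with
    | startCex h =>
      have h₀ := P.satisfiable_initC_badC_iff.1 h
      obtain ⟨I, hI⟩ := id h₀
      exact ⟨⟨h₀, fun _ _ => Nat.zero_le _⟩, fun h => absurd h (lt_irrefl 0), I, hI,
        fun p hp => absurd hp (Set.notMem_empty p)⟩
    | startLoop h =>
      exact ⟨_, 1, (image_const_Icc _ _).symm, makeSafeInv_one hbad h⟩
  | makeSafe N Q K =>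
    obtain ⟨f, i, rfl, hf⟩ := hc
    cases hf.makeSafeStep habs hmbp hitp h with
    | cex => exact hf.shortestCex
    | predecessor _ _ _ h₁ => exact ⟨_, _, rfl, h₁⟩
    | newLemma _ _ h₁ => exact ⟨_, _, rfl, h₁⟩
    | blocked => exact hf.pushInv
  | push N Q =>
    have hc : PushInv P N Q := hc
    cases h with
    | push hl => exact hc.insert hl
    | safe h =>
      obtain ⟨i, hi, hsub⟩ := h
      exact hc.trace.not_hasCex_of_allSubset hc.safe hi hsub
    | unfold h =>
      exact ⟨_, N + 1, (image_const_Icc _ _).symm, hc.makeSafeInv hbad⟩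
  | cex => cases h
  | safe => cases h

/-- Only the two results have no successor. -/
theorem result_of_terminal {c : Cfg X} (h : ∀ d, ¬ Step P abs mbp itp c d) :
    (∃ N K, c = .cex N K) ∨ ∃ N, c = .safe N := by
  cases c with
  | start =>
    by_cases hs : Satisfiable (.and P.initC P.badC)
    · exact absurd (.startCex hs) (h _)
    · exact absurd (.startLoop hs) (h _)
  | makeSafe N Q K =>
    rcases K.eq_empty_or_nonempty with rfl | hK
    · exact absurd .blocked (h _)
    · obtain ⟨p, hp, hmin⟩ := exists_minimalFor_of_wellFoundedLT (· ∈ K) Pob.level hK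
      have htop : IsTop p K := ⟨hp, fun q hq => by
        rcases le_total p.level q.level with hle | hle
        exacts [hle, hmin hq hle]⟩
      rcases hl : p.level with _ | i
      · exact absurd (.cex htop hl) (h _)
      · by_cases hs : Satisfiable (.and (qi (Q i)) (.and P.trC p.cube.primeSk))
        · obtain ⟨M, hM⟩ := hs
          exact absurd (.predecessor htop hl hM rfl rfl rfl) (h _)
        -- The lemma without generalization is always admissible.
        · exact absurd (.newLemma htop hl hs rfl rfl (Or.inl rfl)) (h _)
  | push N Q =>
    by_cases hs : ∃ i < N, AllSubset (Q i) (Q (i + 1))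
    · exact absurd (.safe hs) (h _)
    · exact absurd (.unfold hs) (h _)
  | cex N K => exact Or.inl ⟨N, K, rfl⟩
  | safe N => exact Or.inr ⟨N, rfl⟩

end Correctness

end Quic3

theorem mainTheorem1 {X : Quic3.Srt → Type*} (P : Quic3.SafetyProblem X)
    (hbad : P.bad.IsMonomial)
    (abs : Set (Quic3.Sym (Quic3.Con X)) → Quic3.Fml (Quic3.Con X) →
      Quic3.Fml (Quic3.Con X) × Quic3.Subst (Quic3.Con X))
    (mbp : Set (Quic3.Sym (Quic3.Con X)) → Quic3.Fml (Quic3.Con X) → Quic3.Interp (Quic3.Con X) →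
      Quic3.Fml (Quic3.Con X) × Set (Quic3.Sym (Quic3.Con X)))
    (itp : Quic3.Fml (Quic3.Con X) → Quic3.Fml (Quic3.Con X) →
      Quic3.Fml (Quic3.Con X) × Set (Quic3.Sym (Quic3.Con X)))
    (habs : Quic3.IsAbs abs) (hmbp : Quic3.IsPMbp mbp) (hitp : Quic3.IsPItp itp)
    (hcex : ∃ k, P.HasCex k) :
    -- every run terminates
    (¬ ∃ c : ℕ → Quic3.Cfg X, c 0 = .start ∧ ∀ n, Quic3.Step P abs mbp itp (c n) (c (n + 1))) ∧
    -- and every terminated run has returned a shortest counterexample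
    ∀ c, Relation.ReflTransGen (Quic3.Step P abs mbp itp) .start c →
      (∀ d, ¬ Quic3.Step P abs mbp itp c d) →
      ∃ N K, c = .cex N K ∧ IsLeast {k | P.HasCex k} N ∧
        (0 < N → ∀ j ≤ N, ∃ p ∈ K, p.level = j) ∧
        ∃ I : Quic3.Interp (Quic3.Timed X), Quic3.Models I (P.bmc N) ∧
          ∀ p ∈ K, ∀ M : Quic3.Interp (Quic3.Con X),
            (∀ s (a : X s), M s (.base a) = I s (p.level, a)) → Quic3.ModelsEx M p.cube := by
  obtain ⟨k, hk⟩ := hcex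
  refine ⟨Quic3.not_exists_infinite_of_acc (Quic3.acc_start habs hmbp hitp hbad hk), ?_⟩
  intro c hc hterm
  have hinv : Quic3.CfgInv P c := by
    clear hterm
    induction hc with
    | refl => trivial
    | tail _ hstep ih => exact ih.step habs hmbp hitp hbad hstep
  rcases Quic3.result_of_terminal hterm with ⟨N, K, rfl⟩ | ⟨N, rfl⟩
  · exact ⟨N, K, rfl, hinv⟩
  · exact absurd hk (hinv k)
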